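/- **Setting.** Let $\mathcal H=\{\tau\in\mathbb C:\operatorname{Im}\tau>0\}$, let $\mathrm{SL}_2(\mathbb Z)$ act on $\mathcal H$ by linear fractional transformations, and put $j(\gamma,\tau)=c\tau+d$ for $\gamma=\begin{pmatrix}a&b\\c&d\end{pmatrix}$. For real $s$ and $z\in\mathbb C^\times$ let $z^s=|z|^se^{is\arg z}$ with $\arg z\in(-\pi,\pi]$. Let $p\ge1$ be an integer and $k>2$ a real number. Let $v:\mathrm{SL}_2(\mathbb Z)\to\{|z|=1\}$ be a unitary multiplier system of weight $k$, i.e. $\mu(\gamma,\tau)=v(\gamma)j(\gamma,\tau)^k$ satisfies $\mu(\gamma_1\gamma_2,\tau)=\mu(\gamma_1,\gamma_2.\tau)\mu(\gamma_2,\tau)$, with $v(-I)=(-1)^{-k}$. With $T=\begin{pmatrix}1&1\\0&1\end{pmatrix}$, define $\kappa\in[0,1)$ by $v(T)=e^{2\pi i\kappa}$. For $F$ on $\mathcal H$ with values in $\mathbb C$ or $\mathbb C^p$ put $(F|_k\gamma)(\tau)=v(\gamma)^{-1}j(\gamma,\tau)^{-k}F(\gamma.\tau)$. Let $\Gamma\ni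 -I$ be a subgroup of finite index in $\mathrm{SL}_2(\mathbb Z)$ and let $\rho:\Gamma\to\mathrm{GL}_p(\mathbb C)$ be a unitary representation that is normal, i.e. $\rho(-I)=I_p$, and whenever $\sigma\in\mathrm{SL}_2(\mathbb Z)$ and $M\ge1$ are such that $\sigma T^M\sigma^{-1}\in\Gamma$, there is $N\ge1$ with $\bigl(e^{2\pi i\kappa M}\rho(\sigma T^M\sigma^{-1})\bigr)^N=I_p$. Let $\mathcal S(k,\rho,\Gamma)$ be the space of $F=(F_1,\dots,F_p):\mathcal H\to\mathbb C^p$ with $F|_k\gamma=\rho(\gamma)F$ for all $\gamma\in\Gamma$ such that every $F_i$ is holomorphic and, for every $\sigma\in\mathrm{SL}_2(\mathbb Z)$, $F_i|_k\sigma$ has an expansion $\sum_{n\ge1}a_ne^{2\pi in\tau/N}$ on $\mathcal H$ for some integer $N\ge1$. For $F,G\in\mathcal S(k,\rho,\Gamma)$ let $$\langle F,G\rangle=\int_{\Gamma\backslash\mathcal H}\sum_{i=1}^pF_i(\tau)\overline{G_i(\tau)}\,(\operatorname{Im}\tau)^k\,\frac{dx\,dy}{y^2},\qquad \tau=x+iy,$$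 the integral being taken over any fundamental domain for $\Gamma$ (up to null sets). **Proposition.** Let $\nu\ge0$ be an integer and $\xi\in\mathcal H$. For $u\in\mathbb C^p$ put $f_u(\tau)=\dfrac{(\tau-\xi)^\nu}{(\tau-\overline\xi)^{\nu+k}}\,u$. 1. For every $u\in\mathbb C^p$, the series $$\Phi_{k,\rho,\Gamma,\nu,\xi,u}=\sum_{\gamma\in\langle -I\rangle\backslash\Gamma}\rho(\gamma)^{-1}\,(f_u|_k\gamma)$$ converges absolutely and uniformly on compact subsets of $\mathcal H$ (the series of norms also converges uniformly on compact sets), and its sum is an element of $\mathcal S(k,\rho,\Gamma)$. 2. Let $1\le j\le p$, let $e_j$ be the $j$-th standard basis vector of $\mathbb C^p$, and let $F\in\mathcal S(k,\rho,\Gamma)$. There is a unique sequence $(b_{n,\xi}(j))_{n\ge0}$ of complex numbers with $$(\tau-\overline\xi)^kF_j(\tau)=\sum_{n=0}^\infty b_{n,\xi}(j)\left(\frac{\tau-\xi}{\tau-\overline\xi}\right)^n\qquad(\tau\in\mathcal H),$$ the integral defining $\langle F,\Phi_{k,\rho,\Gamma,\nu,\xi,e_j}\rangle$ converges absolutely,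 and $$\langle F,\Phi_{k,\rho,\Gamma,\nu,\xi,e_j}\rangle=\frac{4\pi}{(4\operatorname{Im}\xi)^k}\cdot\frac{\nu!}{(k-1)k\cdots(k+\nu-1)}\;b_{\nu,\xi}(j).$$ -/

import Mathlib

open scoped UpperHalfPlane MatrixGroups Manifold ComplexConjugate
open MeasureTheory

noncomputable section

namespace VVMF

/-- The value space `ℂ^p` with its standard Hermitian norm. -/
abbrev Vec (p : ℕ) : Type := EuclideanSpace ℂ (Fin p)

/-- The factor `j(γ, τ) = c τ + d`. -/
def jFactor (γ : SL(2, ℤ)) (τ : ℍ) : ℂ := (γ 1 0 : ℂ) * (τ : ℂ) + (γ 1 1 : ℂ)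

/-- `v` is a unitary multiplier system for `SL₂(ℤ)` of real weight `k` with the nontriviality
condition `v(-I) = (-1)^{-k}`. Complex powers are those of the principal branch,
`z^k = |z|^k e^{i k arg z}` with `arg z ∈ (-π, π]`. -/
structure IsMultiplierSystem (k : ℝ) (v : SL(2, ℤ) → ℂ) : Prop where
  norm_eq_one : ∀ γ, ‖v γ‖ = 1
  cocycle : ∀ (γ₁ γ₂ : SL(2, ℤ)) (τ : ℍ),
    v (γ₁ * γ₂) * jFactor (γ₁ * γ₂) τ ^ (k : ℂ) =
      (v γ₁ * jFactor γ₁ (γ₂ • τ) ^ (k : ℂ)) * (v γ₂ * jFactor γ₂ τ ^ (k : ℂ))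
  map_neg_one : v (-1) = (-1 : ℂ) ^ (-(k : ℂ))

/-- The number `κ ∈ [0, 1)` determined by `v(T) = e^{2 π i κ}`, where `T = (1 1; 0 1)`. -/
def kappa (v : SL(2, ℤ) → ℂ) : ℝ := Int.fract (Complex.arg (v ModularGroup.T) / (2 * Real.pi))

lemma kappa_mem (v : SL(2, ℤ) → ℂ) : kappa v ∈ Set.Ico (0 : ℝ) 1 :=
  ⟨Int.fract_nonneg _, Int.fract_lt_one _⟩

lemma exp_kappa {k : ℝ} {v : SL(2, ℤ) → ℂ} (hv : IsMultiplierSystem k v) :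
    Complex.exp (2 * Real.pi * Complex.I * kappa v) = v ModularGroup.T := by
  have h := Complex.norm_mul_exp_arg_mul_I (v ModularGroup.T)
  rw [hv.norm_eq_one, Complex.ofReal_one, one_mul] at h
  refine Eq.trans ?_ h
  rw [Complex.exp_eq_exp_iff_exists_int]
  refine ⟨-⌊Complex.arg (v ModularGroup.T) / (2 * Real.pi)⌋, ?_⟩
  have hpi : (Real.pi : ℂ) ≠ 0 := by exact_mod_cast Real.pi_ne_zero
  rw [kappa, Int.fract]
  push_cast
  field_simp
  ring

/-- The weight `k` slash operator `(F|_k γ)(τ) = v(γ)⁻¹ j(γ,τ)^{-k} F(γ.τ)`, for functions on `ℍ`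
with values in a complex vector space. -/
def slash {E : Type*} [AddCommGroup E] [Module ℂ E] (k : ℝ) (v : SL(2, ℤ) → ℂ) (F : ℍ → E)
    (γ : SL(2, ℤ)) (τ : ℍ) : E :=
  ((v γ)⁻¹ * jFactor γ τ ^ (-(k : ℂ))) • F (γ • τ)

/-- A matrix acting on the column vectors in `ℂ^p`. -/
def act {p : ℕ} (A : Matrix (Fin p) (Fin p) ℂ) (x : Vec p) : Vec p := WithLp.toLp 2 (A.mulVec x)

variable {p : ℕ} {Γ : Subgroup SL(2, ℤ)}

/-- The operator `F|_{k,ρ} γ = ρ(γ)⁻¹ (F|_k γ)` for `γ ∈ Γ`. -/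
def slashRep (k : ℝ) (v : SL(2, ℤ) → ℂ) (ρ : Γ →* GL (Fin p) ℂ) (F : ℍ → Vec p) (γ : Γ) (τ : ℍ) :
    Vec p :=
  act ((ρ γ)⁻¹ : GL (Fin p) ℂ) (slash k v F γ τ)

/-- `f(τ) = ∑_{n ≥ h} a_n e^{2 π i n τ / N}` on `ℍ` for some positive integer `N` and some
complex coefficients `a_n`; the summation variable is `m = n - h`. -/
def HasFourierExpansionFrom (h : ℤ) (f : ℍ → ℂ) : Prop :=
  ∃ N : ℕ, 0 < N ∧ ∃ a : ℕ → ℂ, ∀ τ : ℍ,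
    HasSum (fun m : ℕ =>
      a m * Complex.exp (2 * Real.pi * Complex.I * (((h : ℂ) + (m : ℂ)) / (N : ℂ)) * (τ : ℂ))) (f τ)

/-- The space `𝓕(k)` of holomorphic functions all of whose slash translates `f|_k σ`,
`σ ∈ SL₂(ℤ)`, have a Fourier expansion with finitely many terms of negative index. -/
def IsFormF (k : ℝ) (v : SL(2, ℤ) → ℂ) (f : ℍ → ℂ) : Prop :=
  MDifferentiable 𝓘(ℂ) 𝓘(ℂ) f ∧
    ∀ σ : SL(2, ℤ), ∃ h : ℤ, HasFourierExpansionFrom h (slash k v f σ)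

/-- The space `𝓢(k)`: the functions in `𝓕(k)` for which all these Fourier expansions have
terms of positive index only. -/
def IsFormS (k : ℝ) (v : SL(2, ℤ) → ℂ) (f : ℍ → ℂ) : Prop :=
  IsFormF k v f ∧ ∀ σ : SL(2, ℤ), ∃ h : ℤ, 0 < h ∧ HasFourierExpansionFrom h (slash k v f σ)

/-- The space `𝓕(k, ρ, Γ)` of vector-valued modular forms. -/
def IsVVMF (k : ℝ) (v : SL(2, ℤ) → ℂ) (ρ : Γ →* GL (Fin p) ℂ) (F : ℍ → Vec p) : Prop :=
  (∀ i, IsFormF k v fun τ => F τ i) ∧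
    ∀ (γ : Γ) (τ : ℍ), slash k v F γ τ = act (ρ γ : Matrix (Fin p) (Fin p) ℂ) (F τ)

/-- The space `𝓢(k, ρ, Γ) = 𝓕(k, ρ, Γ) ∩ 𝓢(k)^p` of cuspidal vector-valued modular forms. -/
def IsCuspidalVVMF (k : ℝ) (v : SL(2, ℤ) → ℂ) (ρ : Γ →* GL (Fin p) ℂ) (F : ℍ → Vec p) : Prop :=
  IsVVMF k v ρ F ∧ ∀ i, IsFormS k v fun τ => F τ i

/-- `ρ` is unitary. -/
def IsUnitaryRep (ρ : Γ →* GL (Fin p) ℂ) : Prop :=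
  ∀ γ : Γ, (ρ γ : Matrix (Fin p) (Fin p) ℂ) ∈ Matrix.unitaryGroup (Fin p) ℂ

/-- `ρ` is a normal representation of `Γ ∋ -I`: `ρ(-I) = I_p`, and whenever `σ T^M σ⁻¹ ∈ Γ` with
`M ≥ 1`, some positive power of `e^{2 π i κ M} ρ(σ T^M σ⁻¹)` is `I_p`. -/
structure IsNormalRep (v : SL(2, ℤ) → ℂ) (hΓ : -1 ∈ Γ) (ρ : Γ →* GL (Fin p) ℂ) : Prop where
  map_neg_one : ρ ⟨-1, hΓ⟩ = 1
  exists_pow : ∀ (σ : SL(2, ℤ)) (M : ℕ), 0 < M → ∀ h : σ * ModularGroup.T ^ M * σ⁻¹ ∈ Γ,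
    ∃ N : ℕ, 0 < N ∧
      (Complex.exp (2 * Real.pi * Complex.I * kappa v * (M : ℂ)) •
        (ρ ⟨σ * ModularGroup.T ^ M * σ⁻¹, h⟩ : Matrix (Fin p) (Fin p) ℂ)) ^ N = 1

/-- The set `Λ\Γ` of right cosets `Λγ`. -/
abbrev RightCosets (Λ : Subgroup Γ) : Type := Quotient (QuotientGroup.rightRel Λ)

/-- The term of the Poincaré series of `f` at a coset `Λγ`, that is `f|_{k,ρ} γ`. It does not depend
on the representative `γ` when `f` is invariant under `Λ`, see `poincareTerm_mk`. -/
def poincareTerm (k : ℝ) (v : SL(2, ℤ) → ℂ) (ρ : Γ →* GL (Fin p) ℂ) (Λ : Subgroup Γ)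
    (f : ℍ → Vec p) (q : RightCosets Λ) : ℍ → Vec p :=
  slashRep k v ρ f q.out

lemma jFactor_ne_zero (γ : SL(2, ℤ)) (τ : ℍ) : jFactor γ τ ≠ 0 := by
  have h := UpperHalfPlane.denom_ne_zero (γ : GL (Fin 2) ℝ) τ
  rwa [ModularGroup.denom_apply] at h

lemma act_mul (A B : Matrix (Fin p) (Fin p) ℂ) (x : Vec p) : act (A * B) x = act A (act B x) := by
  simp [act, Matrix.mulVec_mulVec]

lemma act_smul (A : Matrix (Fin p) (Fin p) ℂ) (c : ℂ) (x : Vec p) :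
    act A (c • x) = c • act A x := by
  simp [act, Matrix.mulVec_smul]

lemma slashRep_mul {k : ℝ} {v : SL(2, ℤ) → ℂ} (hv : IsMultiplierSystem k v)
    (ρ : Γ →* GL (Fin p) ℂ) (F : ℍ → Vec p) (γ₁ γ₂ : Γ) :
    slashRep k v ρ F (γ₁ * γ₂) = slashRep k v ρ (slashRep k v ρ F γ₁) γ₂ := by
  funext τ
  have h := hv.cocycle γ₁ γ₂ τ
  have h' : (v (γ₁ * γ₂))⁻¹ * jFactor (γ₁ * γ₂) τ ^ (-(k : ℂ)) =
      ((v γ₂)⁻¹ * jFactor γ₂ τ ^ (-(k : ℂ))) *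
        ((v γ₁)⁻¹ * jFactor γ₁ ((γ₂ : SL(2, ℤ)) • τ) ^ (-(k : ℂ))) := by
    simp only [Complex.cpow_neg, ← mul_inv]
    rw [h, mul_comm]
  simp only [slashRep, slash, map_mul, mul_inv_rev, Units.val_mul, act_mul, act_smul,
    Subgroup.coe_mul, h', mul_smul]

lemma poincareTerm_mk {k : ℝ} {v : SL(2, ℤ) → ℂ} (hv : IsMultiplierSystem k v)
    (ρ : Γ →* GL (Fin p) ℂ) (Λ : Subgroup Γ) (f : ℍ → Vec p)
    (hf : ∀ l ∈ Λ, slashRep k v ρ f l = f) (γ : Γ) :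
    poincareTerm k v ρ Λ f (Quotient.mk (QuotientGroup.rightRel Λ) γ) = slashRep k v ρ f γ := by
  have h : QuotientGroup.rightRel Λ
      (Quotient.mk (QuotientGroup.rightRel Λ) γ).out γ := Quotient.mk_out γ
  rw [QuotientGroup.rightRel_apply] at h
  have h2 := slashRep_mul hv ρ f (γ * (Quotient.mk (QuotientGroup.rightRel Λ) γ).out⁻¹)
    (Quotient.mk (QuotientGroup.rightRel Λ) γ).out
  rw [inv_mul_cancel_right, hf _ h] at h2
  exact h2.symm

/-- The Poincaré series `P_{Λ\Γ,ρ} f = ∑_{γ ∈ Λ\Γ} f|_{k,ρ} γ`. -/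
def poincareSeries (k : ℝ) (v : SL(2, ℤ) → ℂ) (ρ : Γ →* GL (Fin p) ℂ) (Λ : Subgroup Γ)
    (f : ℍ → Vec p) (τ : ℍ) : Vec p :=
  ∑' q : RightCosets Λ, poincareTerm k v ρ Λ f q τ

/-- The subgroup `⟨-I⟩` of `Γ`. -/
def negOneSubgroup (hΓ : -1 ∈ Γ) : Subgroup Γ := Subgroup.zpowers ⟨-1, hΓ⟩

/-- Every function is invariant under `⟨-I⟩`. -/
lemma slashRep_negOneSubgroup {k : ℝ} {v : SL(2, ℤ) → ℂ} (hv : IsMultiplierSystem k v)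
    (hΓ : -1 ∈ Γ) (ρ : Γ →* GL (Fin p) ℂ) (hρ : IsNormalRep v hΓ ρ) (f : ℍ → Vec p) :
    ∀ l ∈ negOneSubgroup hΓ, slashRep k v ρ f l = f := by
  have h1 : slashRep k v ρ f ⟨-1, hΓ⟩ = f := by
    funext τ
    have hj : jFactor (-1) τ = -1 := by simp [jFactor]
    have h0 : (-1 : ℂ) ^ (-(k : ℂ)) ≠ 0 := by simp [Complex.cpow_eq_zero_iff]
    simp [slashRep, slash, hρ.map_neg_one, hv.map_neg_one, hj, h0, act]
  have hsq : (⟨-1, hΓ⟩ : Γ) * ⟨-1, hΓ⟩ = 1 := by ext1; simp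
  have h2 : slashRep k v ρ f 1 = f := by rw [← hsq, slashRep_mul hv, h1, h1]
  rintro l ⟨n, rfl⟩
  have hsq' : (⟨-1, hΓ⟩ : Γ) ^ (2 : ℤ) = 1 := by rw [zpow_two, hsq]
  rcases Int.even_or_odd' n with ⟨m, rfl | rfl⟩
  · simpa [zpow_mul, hsq'] using h2
  · simpa [zpow_add, zpow_mul, hsq'] using h1

/-- The function `τ ↦ (τ - ξ)^ν / (τ - ξ̄)^{ν + k} • u`. -/
def ellipticSeed (k : ℝ) (ν : ℕ) (ξ : ℍ) (u : Vec p) (τ : ℍ) : Vec p :=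
  (((τ : ℂ) - (ξ : ℂ)) ^ ν / ((τ : ℂ) - conj (ξ : ℂ)) ^ ((ν : ℂ) + (k : ℂ))) • u

/-- The terms, indexed by `⟨-I⟩\Γ`, of the elliptic vector-valued Poincaré series. -/
def ellipticTerm (k : ℝ) (v : SL(2, ℤ) → ℂ) (hΓ : -1 ∈ Γ) (ρ : Γ →* GL (Fin p) ℂ) (ν : ℕ) (ξ : ℍ)
    (u : Vec p) : RightCosets (negOneSubgroup hΓ) → ℍ → Vec p :=
  poincareTerm k v ρ (negOneSubgroup hΓ) (ellipticSeed k ν ξ u)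

/-- The elliptic vector-valued Poincaré series `Φ_{k,ρ,Γ,ν,ξ,u}`. -/
def ellipticSeries (k : ℝ) (v : SL(2, ℤ) → ℂ) (hΓ : -1 ∈ Γ) (ρ : Γ →* GL (Fin p) ℂ) (ν : ℕ) (ξ : ℍ)
    (u : Vec p) : ℍ → Vec p :=
  poincareSeries k v ρ (negOneSubgroup hΓ) (ellipticSeed k ν ξ u)

/-- `(τ - ξ̄)^k F_j(τ) = ∑_n b_n ((τ - ξ) / (τ - ξ̄))^n` for all `τ ∈ ℍ`. -/
def HasEllipticExpansion (k : ℝ) (ξ : ℍ) (f : ℍ → ℂ) (b : ℕ → ℂ) : Prop :=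
  ∀ τ : ℍ, HasSum (fun n : ℕ => b n * (((τ : ℂ) - (ξ : ℂ)) / ((τ : ℂ) - conj (ξ : ℂ))) ^ n)
    (((τ : ℂ) - conj (ξ : ℂ)) ^ (k : ℂ) * f τ)

/-- `D` is a fundamental domain for the action of `Γ` on `ℍ`, up to null sets of the invariant
measure `dx dy / y²` (Mathlib's `volume` on `ℍ`). As `-I` acts trivially, Mathlib's notion is
applied to the group of transformations of `ℍ` induced by `Γ`. -/
def IsFundDomain (Γ : Subgroup SL(2, ℤ)) (D : Set ℍ) : Prop :=
  IsFundamentalDomain (Γ.map (MulAction.toPermHom SL(2, ℤ) ℍ)) D volume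

/-- The boundary of the standard fundamental domain of `SL₂(ℤ)` is a null set. -/
lemma volume_fd_diff_fdo : volume (ModularGroup.fd \ ModularGroup.fdo) = 0 := by
  have hre : ∀ c : ℝ, volume {z : ℂ | z.re = c} = 0 := by
    intro c
    have h := Complex.volume_preserving_equiv_real_prod.measure_preimage
      (s := ({c} : Set ℝ) ×ˢ Set.univ)
      ((measurableSet_singleton c).prod MeasurableSet.univ).nullMeasurableSet
    rw [Measure.volume_eq_prod, Measure.prod_prod, Real.volume_singleton, zero_mul] at h
    refine measure_mono_null ?_ h
    intro z hz
    simpa [Complex.measurableEquivRealProd] using hz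
  rw [UpperHalfPlane.volume_def]
  refine withDensity_absolutelyContinuous _ _ ?_
  rw [UpperHalfPlane.measurableEmbedding_coe.comap_apply]
  refine measure_mono_null (t := ({z : ℂ | z.re = 1 / 2} ∪ {z : ℂ | z.re = -(1 / 2)}) ∪
    Metric.sphere 0 1) ?_ ?_
  · rintro _ ⟨τ, ⟨⟨h1, h2⟩, h3⟩, rfl⟩
    by_cases hn : Complex.normSq (τ : ℂ) = 1
    · right
      rw [mem_sphere_zero_iff_norm]
      rw [Complex.normSq_eq_norm_sq] at hn
      exact (pow_eq_one_iff_of_nonneg (norm_nonneg _) two_ne_zero).1 hn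
    · left
      have h4 : |τ.re| = 1 / 2 := by
        by_contra h5
        exact h3 ⟨lt_of_le_of_ne h1 (Ne.symm hn), lt_of_le_of_ne h2 h5⟩
      rcases (abs_eq (by norm_num)).1 h4 with h | h
      · exact Or.inl h
      · exact Or.inr h
  · exact measure_union_null (measure_union_null (hre _) (hre _)) (Measure.addHaar_sphere _ _ _)

/-- Every subgroup `Γ ∋ -I` of finite index in `SL₂(ℤ)` has a fundamental domain: the union of the
translates of the standard one for `SL₂(ℤ)` by representatives of the right cosets of `Γ`. -/
lemma exists_isFundDomain [Γ.FiniteIndex] (hΓ : -1 ∈ Γ) : ∃ D : Set ℍ, IsFundDomain Γ D := by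
  have hfin : Finite (Quotient (QuotientGroup.rightRel Γ)) :=
    Finite.of_equiv _ (QuotientGroup.quotientRightRelEquivQuotientLeftRel Γ).symm
  have hpre : ∀ (a : SL(2, ℤ)) (s : Set ℍ), volume s = 0 → volume {τ : ℍ | a • τ ∈ s} = 0 := by
    intro a s hs
    have h := measure_preimage_smul (volume : Measure ℍ) (a : GL (Fin 2) ℝ) s
    rw [hs] at h
    exact h
  have hnull : ∀ a b : SL(2, ℤ), a ≠ b → a ≠ -b →
      volume {τ : ℍ | a • τ ∈ ModularGroup.fd ∧ b • τ ∈ ModularGroup.fd} = 0 := by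
    intro a b h1 h2
    refine measure_mono_null ?_ (hpre a _ volume_fd_diff_fdo)
    rintro τ ⟨ha, hb⟩
    refine ⟨ha, fun ho => ?_⟩
    have hb' : (b * a⁻¹) • (a • τ) ∈ ModularGroup.fd := by rwa [mul_smul, inv_smul_smul]
    rcases ModularGroup.eq_one_or_neg_one_of_mem_fdo_mem_fd ho hb' with h | h
    · exact h1 (mul_inv_eq_one.1 h).symm
    · apply h2
      rw [mul_inv_eq_iff_eq_mul] at h
      simp [h]
  refine ⟨⋃ q : Quotient (QuotientGroup.rightRel Γ), {τ : ℍ | q.out⁻¹ • τ ∈ ModularGroup.fd},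
    ?_, ?_, ?_⟩
  · refine (MeasurableSet.iUnion fun q => ?_).nullMeasurableSet
    have hc : Continuous fun τ : ℍ => q.out⁻¹ • τ :=
      continuous_const_smul ((q.out⁻¹ : SL(2, ℤ)) : GL (Fin 2) ℝ)
    exact (ModularGroup.isClosed_fd.preimage hc).measurableSet
  · refine Filter.Eventually.of_forall fun τ => ?_
    obtain ⟨g, hg⟩ := ModularGroup.exists_smul_mem_fd τ
    have h : QuotientGroup.rightRel Γ
      (Quotient.mk (QuotientGroup.rightRel Γ) g⁻¹).out g⁻¹ := Quotient.mk_out g⁻¹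
    rw [QuotientGroup.rightRel_apply] at h
    refine ⟨⟨_, Subgroup.mem_map_of_mem _ (Γ.inv_mem h)⟩, Set.mem_iUnion.2
      ⟨Quotient.mk (QuotientGroup.rightRel Γ) g⁻¹, ?_⟩⟩
    change (Quotient.mk (QuotientGroup.rightRel Γ) g⁻¹).out⁻¹ •
      (g⁻¹ * (Quotient.mk (QuotientGroup.rightRel Γ) g⁻¹).out⁻¹)⁻¹ • τ ∈ ModularGroup.fd
    rw [smul_smul]
    simpa using hg
  · rintro ⟨_, γ, hγ, rfl⟩ ⟨_, δ, hδ, rfl⟩ hne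
    have h1 : γ ≠ δ := by
      rintro rfl
      exact hne rfl
    have h2 : γ ≠ -δ := by
      rintro rfl
      apply hne
      ext1
      apply Equiv.ext
      intro τ
      exact ModularGroup.SL_neg_smul δ τ
    refine measure_mono_null (t := ⋃ q : Quotient (QuotientGroup.rightRel Γ),
      ⋃ q' : Quotient (QuotientGroup.rightRel Γ),
        {τ : ℍ | (q.out⁻¹ * γ⁻¹) • τ ∈ ModularGroup.fd ∧
          (q'.out⁻¹ * δ⁻¹) • τ ∈ ModularGroup.fd}) ?_ ?_
    · rintro τ ⟨⟨τ₁, hτ₁, h₁⟩, τ₂, hτ₂, h₂⟩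
      obtain ⟨q, hq⟩ := Set.mem_iUnion.1 hτ₁
      obtain ⟨q', hq'⟩ := Set.mem_iUnion.1 hτ₂
      have e₁ : γ • τ₁ = τ := h₁
      have e₂ : δ • τ₂ = τ := h₂
      refine Set.mem_iUnion.2 ⟨q, Set.mem_iUnion.2 ⟨q', ?_, ?_⟩⟩
      · rw [← e₁, mul_smul, inv_smul_smul]
        exact hq
      · rw [← e₂, mul_smul, inv_smul_smul]
        exact hq'
    · refine measure_iUnion_null fun q => measure_iUnion_null fun q' => ?_
      have key : ∀ ε ∈ Γ, δ * q'.out = ε * (γ * q.out) → q' = q := by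
        intro ε hε h
        rw [← Quotient.out_eq q, ← Quotient.out_eq q']
        apply Quotient.sound
        change QuotientGroup.rightRel Γ _ _
        rw [QuotientGroup.rightRel_apply]
        have : q.out * q'.out⁻¹ = γ⁻¹ * ε⁻¹ * δ := by
          rw [mul_inv_eq_iff_eq_mul, mul_assoc, h]
          group
        rw [this]
        exact Γ.mul_mem (Γ.mul_mem (Γ.inv_mem hγ) (Γ.inv_mem hε)) hδ
      apply hnull
      · intro h
        have h' : δ * q'.out = 1 * (γ * q.out) := by
          rw [one_mul, ← inv_inj, mul_inv_rev, mul_inv_rev, h]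
        obtain rfl := key 1 Γ.one_mem h'
        exact h1 (by simpa using h'.symm)
      · intro h
        have h' : δ * q'.out = -1 * (γ * q.out) := by
          rw [← inv_inj, mul_inv_rev, neg_one_mul, inv_neg, mul_inv_rev, h, neg_neg]
        obtain rfl := key (-1) hΓ h'
        refine h2 ?_
        have h3 : δ = -γ := by
          rw [← mul_assoc] at h'
          simpa using mul_right_cancel h'
        rw [h3, neg_neg]

/-- The function `⟨F(τ), G(τ)⟩ Im(τ)^k`, where `⟨x, y⟩ = ∑ x_i ȳ_i`. -/
def peterssonIntegrand (k : ℝ) (F G : ℍ → Vec p) (τ : ℍ) : ℂ :=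
  (∑ i, F τ i * conj (G τ i)) * ((τ.im ^ k : ℝ) : ℂ)

/-- The Petersson inner product `∫_{Γ\ℍ} ⟨F(τ), G(τ)⟩ Im(τ)^k dx dy / y²`, computed on a
fundamental domain `D` for `Γ`. -/
def peterssonInner (k : ℝ) (D : Set ℍ) (F G : ℍ → Vec p) : ℂ :=
  ∫ τ in D, peterssonIntegrand k F G τ

end VVMF

end

noncomputable section

namespace VVMF

/-! ### The automorphy factor and the slash operator -/

section Slash

/-! Convergence and cuspidality come from one scalar majorant. Since |τ - ξ| ≤ |τ - ξ̄| and ρ and v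
are unitary, the term of the series at γ = (a b; c d) has norm at most ‖u‖ |L_γ(τ)|^{-k}, where
L_γ(τ) = (aτ + b) - ξ̄(cτ + d) is `linForm`. The zero of the affine function L_γ lies in the lower
half-plane, so |L_γ(τ)| is comparable to |L_γ(ξ)| uniformly in γ, for τ in a compact set. At ξ the
sum over all of `SL₂(ℤ)` splits into a sum over bottom rows (c, d) and a sum over translations; it
converges for k > 2 (`summable_norm_linForm_base`). This gives uniform convergence and holomorphy.
The full sum also bounds every translate Φ|σ and tends to 0 at i∞ (`tendsto_majorant`); normality of
ρ makes Φ|σ periodic (`exists_period`), so Φ|σ has a Fourier expansion without constant term.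

The inner product is computed by unfolding. Unitarity of ρ and the transformation law of F turn the
Petersson integrand of F against Φ into a sum of one scalar function, `seedIntegrand`, over the
transformations induced by Γ (`peterssonIntegrand_ellipticSeries`), so its integral over D becomes
an integral over ℍ. In the coordinate w = (τ - ξ)/(τ - ξ̄) the latter is a constant times the
integral over the unit disc of G(w) w̄^ν (1 - |w|²)^{k-2}, where G(w) = (τ - ξ̄)^k F_j(τ) has Taylor
coefficients b_n. Orthogonality on circles isolates b_ν, and the radial integral is a Beta value.
Absolute convergence rests on the boundedness of ‖F‖ Im(τ)^{k/2} (`IsCuspidalVVMF.exists_bound`),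
which leaves the weight (1 - |w|²)^{k/2-2}, integrable because k > 2. -/

lemma jFactor_eq_denom (γ : SL(2, ℤ)) (τ : ℍ) :
    jFactor γ τ = UpperHalfPlane.denom (γ : GL (Fin 2) ℝ) τ := by
  rw [ModularGroup.denom_apply]; rfl

lemma im_smul_eq (γ : SL(2, ℤ)) (τ : ℍ) : (γ • τ).im = τ.im / ‖jFactor γ τ‖ ^ 2 := by
  rw [ModularGroup.im_smul_eq_div_normSq, jFactor_eq_denom, Complex.normSq_eq_norm_sq]

lemma jFactor_mul_coe_smul (γ : SL(2, ℤ)) (τ : ℍ) :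
    jFactor γ τ * ((γ • τ : ℍ) : ℂ) = (γ 0 0 : ℂ) * τ + (γ 0 1 : ℂ) := by
  have h := UpperHalfPlane.coe_specialLinearGroup_apply γ τ
  have h0 := jFactor_ne_zero γ τ
  rw [h]
  simp only [jFactor] at h0 ⊢
  simp only [algebraMap_int_eq, Int.coe_castRingHom, Complex.ofReal_intCast]
  field_simp

lemma jFactor_mul (γ₁ γ₂ : SL(2, ℤ)) (τ : ℍ) :
    jFactor (γ₁ * γ₂) τ = jFactor γ₁ (γ₂ • τ) * jFactor γ₂ τ := by
  rw [mul_comm, jFactor.eq_1 γ₁, mul_add, mul_left_comm, jFactor_mul_coe_smul]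
  simp [jFactor, Matrix.mul_apply, Fin.sum_univ_two]
  ring

variable {k : ℝ} {v : SL(2, ℤ) → ℂ}

lemma IsMultiplierSystem.ne_zero (hv : IsMultiplierSystem k v) (γ : SL(2, ℤ)) : v γ ≠ 0 := by
  intro h; simpa [h] using hv.norm_eq_one γ

lemma slash_mul (hv : IsMultiplierSystem k v) {E : Type*} [AddCommGroup E] [Module ℂ E]
    (F : ℍ → E) (γ₁ γ₂ : SL(2, ℤ)) :
    slash k v F (γ₁ * γ₂) = slash k v (slash k v F γ₁) γ₂ := by
  funext τ
  have h := hv.cocycle γ₁ γ₂ τ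
  have h' : (v (γ₁ * γ₂))⁻¹ * jFactor (γ₁ * γ₂) τ ^ (-(k : ℂ)) =
      ((v γ₂)⁻¹ * jFactor γ₂ τ ^ (-(k : ℂ))) *
        ((v γ₁)⁻¹ * jFactor γ₁ (γ₂ • τ) ^ (-(k : ℂ))) := by
    simp only [Complex.cpow_neg, ← mul_inv]
    rw [h, mul_comm]
  simp only [slash, h', mul_smul]

lemma norm_slash_factor (hv : IsMultiplierSystem k v) (γ : SL(2, ℤ)) (τ : ℍ) :
    ‖(v γ)⁻¹ * jFactor γ τ ^ (-(k : ℂ))‖ = ‖jFactor γ τ‖ ^ (-k) := by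
  rw [norm_mul, norm_inv, hv.norm_eq_one, inv_one, one_mul, ← Complex.ofReal_neg,
    Complex.norm_cpow_real]

lemma norm_slash (hv : IsMultiplierSystem k v) {E : Type*} [NormedAddCommGroup E]
    [NormedSpace ℂ E] (F : ℍ → E) (γ : SL(2, ℤ)) (τ : ℍ) :
    ‖slash k v F γ τ‖ = ‖jFactor γ τ‖ ^ (-k) * ‖F (γ • τ)‖ := by
  rw [slash, norm_smul, norm_slash_factor hv]

lemma im_smul_rpow (γ : SL(2, ℤ)) (τ : ℍ) (s : ℝ) :
    (γ • τ).im ^ s = (‖jFactor γ τ‖ ^ (-s)) ^ 2 * τ.im ^ s := by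
  have h : 0 < ‖jFactor γ τ‖ := norm_pos_iff.2 (jFactor_ne_zero γ τ)
  rw [im_smul_eq, Real.div_rpow τ.im_pos.le (by positivity), ← Real.rpow_natCast,
    ← Real.rpow_natCast, ← Real.rpow_mul h.le, ← Real.rpow_mul h.le, mul_comm (-s),
    mul_neg, Real.rpow_neg h.le]
  field_simp

/-- The factor |j|^{-k} of the slash operator is exactly what Im(τ)^{k/2} picks up under γ. Hence
‖F‖ Im^{k/2} is Γ-invariant for a form F, and its size near any cusp is read off from F|γ near i∞.
-/
lemma norm_slash_mul_im_rpow (hv : IsMultiplierSystem k v) {E : Type*} [NormedAddCommGroup E]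
    [NormedSpace ℂ E] (F : ℍ → E) (γ : SL(2, ℤ)) (τ : ℍ) :
    ‖slash k v F γ τ‖ * τ.im ^ (k / 2) = ‖F (γ • τ)‖ * (γ • τ).im ^ (k / 2) := by
  have h : 0 < ‖jFactor γ τ‖ := norm_pos_iff.2 (jFactor_ne_zero γ τ)
  rw [norm_slash hv, im_smul_rpow, ← Real.rpow_natCast, ← Real.rpow_mul h.le]
  have : -(k / 2) * ((2 : ℕ) : ℝ) = -k := by push_cast; ring
  rw [this]
  ring

lemma IsMultiplierSystem.map_one (hv : IsMultiplierSystem k v) : v 1 = 1 := by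
  have h := hv.cocycle 1 1 UpperHalfPlane.I
  have hj : jFactor 1 UpperHalfPlane.I = 1 := by simp [jFactor]
  rw [one_mul, one_smul, hj, Complex.one_cpow, mul_one] at h
  exact (mul_eq_left₀ (hv.ne_zero 1)).1 h.symm

lemma coe_T_pow (M : ℕ) :
    ((ModularGroup.T ^ M : SL(2, ℤ)) : Matrix (Fin 2) (Fin 2) ℤ) = !![1, (M : ℤ); 0, 1] := by
  simpa using ModularGroup.coe_T_zpow M

lemma jFactor_T_pow (M : ℕ) (τ : ℍ) : jFactor (ModularGroup.T ^ M) τ = 1 := by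
  rw [jFactor, coe_T_pow]
  simp

lemma coe_T_pow_smul (M : ℕ) (τ : ℍ) :
    ((ModularGroup.T ^ M • τ : ℍ) : ℂ) = (τ : ℂ) + M := by
  have h := jFactor_mul_coe_smul (ModularGroup.T ^ M) τ
  rw [jFactor_T_pow, one_mul] at h
  rw [h, coe_T_pow]
  simp

lemma IsMultiplierSystem.map_T_pow (hv : IsMultiplierSystem k v) (M : ℕ) :
    v (ModularGroup.T ^ M) = v ModularGroup.T ^ M := by
  induction M with
  | zero => simpa using hv.map_one
  | succ n ih =>
    have h := hv.cocycle (ModularGroup.T ^ n) ModularGroup.T UpperHalfPlane.I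
    have hT : ∀ τ, jFactor ModularGroup.T τ = 1 := fun τ => by simpa using jFactor_T_pow 1 τ
    rw [← pow_succ, jFactor_T_pow, jFactor_T_pow, hT, Complex.one_cpow, mul_one, mul_one,
      mul_one, ih] at h
    rw [h, pow_succ]

end Slash

/-! ### Unitary matrices acting on ℂ^p -/

section Act

variable {p : ℕ}

lemma act_eq_toEuclideanCLM (A : Matrix (Fin p) (Fin p) ℂ) (x : Vec p) :
    act A x = Matrix.toEuclideanCLM (n := Fin p) (𝕜 := ℂ) A x := rfl

lemma act_one (x : Vec p) : act 1 x = x := by simp [act]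

lemma sum_mul_conj_eq_inner (x y : Vec p) : ∑ i, x i * conj (y i) = inner ℂ y x := by
  simp [PiLp.inner_apply]

lemma inner_act_left (A : Matrix (Fin p) (Fin p) ℂ) (x y : Vec p) :
    inner ℂ (act A x) y = inner ℂ x (act (star A) y) := by
  rw [act_eq_toEuclideanCLM, act_eq_toEuclideanCLM, map_star, ContinuousLinearMap.star_eq_adjoint,
    ContinuousLinearMap.adjoint_inner_right]

lemma norm_act_of_unitary {A : Matrix (Fin p) (Fin p) ℂ}
    (hA : A ∈ Matrix.unitaryGroup (Fin p) ℂ) (x : Vec p) : ‖act A x‖ = ‖x‖ := by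
  have h : inner ℂ (act A x) (act A x) = inner ℂ x x := by
    rw [inner_act_left, ← act_mul, Matrix.mem_unitaryGroup_iff'.1 hA, act_one]
  rw [inner_self_eq_norm_sq_to_K, inner_self_eq_norm_sq_to_K] at h
  have h' : ‖act A x‖ ^ 2 = ‖x‖ ^ 2 := by exact_mod_cast h
  exact (sq_eq_sq₀ (norm_nonneg _) (norm_nonneg _)).1 h'

variable {Γ : Subgroup SL(2, ℤ)} {ρ : Γ →* GL (Fin p) ℂ}

lemma IsUnitaryRep.coe_inv (hρ : IsUnitaryRep ρ) (γ : Γ) :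
    (((ρ γ)⁻¹ : GL (Fin p) ℂ) : Matrix (Fin p) (Fin p) ℂ) = star (ρ γ : Matrix (Fin p) (Fin p) ℂ) := by
  have h := Matrix.mem_unitaryGroup_iff'.1 (hρ γ)
  exact (Units.inv_eq_of_mul_eq_one_left h)

lemma IsUnitaryRep.norm_act_inv (hρ : IsUnitaryRep ρ) (γ : Γ) (x : Vec p) :
    ‖act ((ρ γ)⁻¹ : GL (Fin p) ℂ) x‖ = ‖x‖ := by
  rw [← map_inv]; exact norm_act_of_unitary (hρ _) x

lemma act_act_inv (γ : Γ) (x : Vec p) :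
    act (ρ γ : Matrix (Fin p) (Fin p) ℂ) (act ((ρ γ)⁻¹ : GL (Fin p) ℂ) x) = x := by
  rw [← act_mul, ← Units.val_mul, mul_inv_cancel, Units.val_one, act_one]

lemma norm_slashRep {k : ℝ} {v : SL(2, ℤ) → ℂ} (hv : IsMultiplierSystem k v)
    (hρ : IsUnitaryRep ρ) (F : ℍ → Vec p) (γ : Γ) (τ : ℍ) :
    ‖slashRep k v ρ F γ τ‖ = ‖jFactor γ τ‖ ^ (-k) * ‖F ((γ : SL(2, ℤ)) • τ)‖ := by
  rw [slashRep, hρ.norm_act_inv, norm_slash hv]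

end Act

/-! ### The scalar majorant: convergence and decay at i∞ -/

section Majorant

open Filter Topology

/-- The affine function `τ ↦ (a τ + b) - ξ̄ (c τ + d)` attached to `γ = (a b; c d)`. -/
def linForm (ξ : ℍ) (γ : SL(2, ℤ)) (τ : ℍ) : ℂ :=
  jFactor γ τ * (((γ • τ : ℍ) : ℂ) - conj (ξ : ℂ))

/-- The slope of `linForm`. -/
def linSlope (ξ : ℍ) (γ : SL(2, ℤ)) : ℂ := (γ 0 0 : ℂ) - conj (ξ : ℂ) * (γ 1 0 : ℂ)

lemma linForm_eq (ξ : ℍ) (γ : SL(2, ℤ)) (τ : ℍ) :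
    linForm ξ γ τ = linSlope ξ γ * τ + ((γ 0 1 : ℂ) - conj (ξ : ℂ) * (γ 1 1 : ℂ)) := by
  rw [linForm, mul_sub, jFactor_mul_coe_smul, jFactor, linSlope]
  ring

/-- This is det γ = 1. Writing `linForm` as Aτ + B, it says that the zero -B/A has imaginary part
-Im ξ / |A|², hence lies in the lower half-plane; the lower bound |A| Im τ ≤ |Aτ + B| follows. -/
lemma im_mul_conj_linSlope (ξ : ℍ) (γ : SL(2, ℤ)) :
    (((γ 0 1 : ℂ) - conj (ξ : ℂ) * (γ 1 1 : ℂ)) * conj (linSlope ξ γ)).im = ξ.im := by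
  have h : (γ 0 0 : ℝ) * (γ 1 1 : ℝ) - (γ 0 1 : ℝ) * (γ 1 0 : ℝ) = 1 := by
    have := γ.det_coe
    rw [Matrix.det_fin_two] at this
    exact_mod_cast this
  simp [linSlope]
  linear_combination ξ.im * h

lemma linSlope_ne_zero (ξ : ℍ) (γ : SL(2, ℤ)) : linSlope ξ γ ≠ 0 := by
  intro h
  have h2 := im_mul_conj_linSlope ξ γ
  rw [h] at h2
  simp only [map_zero, mul_zero, Complex.zero_im] at h2
  exact ξ.im_pos.ne h2

lemma norm_linSlope_mul_im_le (ξ : ℍ) (γ : SL(2, ℤ)) (τ : ℍ) :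
    ‖linSlope ξ γ‖ * τ.im ≤ ‖linForm ξ γ τ‖ := by
  have h0 : 0 < ‖linSlope ξ γ‖ := norm_pos_iff.2 (linSlope_ne_zero ξ γ)
  have h1 : (linForm ξ γ τ * conj (linSlope ξ γ)).im = ‖linSlope ξ γ‖ ^ 2 * τ.im + ξ.im := by
    rw [linForm_eq, add_mul, Complex.add_im, im_mul_conj_linSlope, mul_right_comm,
      Complex.mul_conj, Complex.normSq_eq_norm_sq, Complex.im_ofReal_mul, UpperHalfPlane.coe_im]
  have h2 := (le_abs_self _).trans (Complex.abs_im_le_norm (linForm ξ γ τ * conj (linSlope ξ γ)))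
  rw [h1, norm_mul, RCLike.norm_conj] at h2
  have h3 := ξ.im_pos
  refine le_of_mul_le_mul_right ?_ h0
  nlinarith

lemma norm_linForm_pos (ξ : ℍ) (γ : SL(2, ℤ)) (τ : ℍ) : 0 < ‖linForm ξ γ τ‖ :=
  lt_of_lt_of_le (mul_pos (norm_pos_iff.2 (linSlope_ne_zero ξ γ)) τ.im_pos)
    (norm_linSlope_mul_im_le ξ γ τ)

/-- Moving from τ to ξ changes the affine form by slope times displacement, and the slope is at most
|L_γ(τ)| / Im τ. The comparison factor does not depend on γ, so summability at ξ gives it at every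
τ, locally uniformly. -/
lemma norm_linForm_base_le (ξ : ℍ) (γ : SL(2, ℤ)) (τ : ℍ) :
    ‖linForm ξ γ ξ‖ ≤ (1 + ‖(τ : ℂ) - ξ‖ / τ.im) * ‖linForm ξ γ τ‖ := by
  have h : linForm ξ γ ξ = linForm ξ γ τ - linSlope ξ γ * ((τ : ℂ) - ξ) := by
    rw [linForm_eq, linForm_eq]; ring
  have h1 := norm_linSlope_mul_im_le ξ γ τ
  have h2 : ‖linSlope ξ γ‖ * ‖(τ : ℂ) - ξ‖ ≤ ‖(τ : ℂ) - ξ‖ / τ.im * ‖linForm ξ γ τ‖ := by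
    rw [div_mul_eq_mul_div, le_div_iff₀ τ.im_pos]
    nlinarith [norm_nonneg ((τ : ℂ) - ξ)]
  calc ‖linForm ξ γ ξ‖ ≤ ‖linForm ξ γ τ‖ + ‖linSlope ξ γ * ((τ : ℂ) - ξ)‖ := h ▸ norm_sub_le _ _
    _ ≤ _ := by rw [norm_mul, add_mul, one_mul]; gcongr

lemma rpow_neg_norm_linForm_le {k : ℝ} (hk : 0 ≤ k) (ξ : ℍ) (γ : SL(2, ℤ)) (τ : ℍ) :
    ‖linForm ξ γ τ‖ ^ (-k) ≤ (1 + ‖(τ : ℂ) - ξ‖ / τ.im) ^ k * ‖linForm ξ γ ξ‖ ^ (-k) := by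
  have h0 := norm_linForm_pos ξ γ τ
  have h1 := norm_linForm_pos ξ γ ξ
  have h2 : 0 < 1 + ‖(τ : ℂ) - ξ‖ / τ.im := by have := τ.im_pos; positivity
  rw [Real.rpow_neg h0.le, Real.rpow_neg h1.le, ← div_eq_mul_inv, inv_le_comm₀ (by positivity)
    (by positivity), inv_div, div_le_iff₀ (by positivity), mul_comm, ← Real.mul_rpow h2.le h0.le]
  exact Real.rpow_le_rpow h1.le (norm_linForm_base_le ξ γ τ) hk

lemma jFactor_T_zpow (n : ℤ) (τ : ℍ) : jFactor (ModularGroup.T ^ n) τ = 1 := by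
  rw [jFactor, ModularGroup.coe_T_zpow]
  simp

/-- Two matrices with the same bottom row differ by a power of T on the left, which shifts Re(γz) by
an integer; the floor detects that integer. -/
lemma eq_of_bottom_row_eq_of_floor_eq {γ γ' : SL(2, ℤ)} (h0 : γ 1 0 = γ' 1 0)
    (h1 : γ 1 1 = γ' 1 1) (z : ℍ) (x : ℝ)
    (h : ⌊(γ • z).re - x⌋ = ⌊(γ' • z).re - x⌋) : γ = γ' := by
  have hd := γ.det_coe
  have hd' := γ'.det_coe
  rw [Matrix.det_fin_two] at hd hd'
  -- This n is the upper right entry of γ'γ⁻¹ when the bottom rows agree.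
  obtain ⟨n, hn⟩ : ∃ n : ℤ, n = γ' 0 1 * γ 0 0 - γ' 0 0 * γ 0 1 := ⟨_, rfl⟩
  have hT : γ' = ModularGroup.T ^ n * γ := by
    ext i j
    rw [Matrix.SpecialLinearGroup.coe_mul, ModularGroup.coe_T_zpow]
    rw [← h0, ← h1] at hd'
    fin_cases i <;> fin_cases j <;> simp [Matrix.mul_apply, Fin.sum_univ_two, h0, h1] <;>
      rw [← h0, ← h1] at * <;> subst hn
    · linear_combination γ 0 0 * hd' - γ' 0 0 * hd
    · linear_combination γ 0 1 * hd' - γ' 0 1 * hd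
  have hz : (γ' • z).re = (γ • z).re + n := by
    rw [hT, mul_smul, ModularGroup.re_T_zpow_smul]
  have hn0 : n = 0 := by
    rw [hz, show (γ • z).re + n - x = (γ • z).re - x + n by ring, Int.floor_add_intCast] at h
    omega
  rw [hn0, zpow_zero, one_mul] at hT
  exact hT.symm

lemma mul_one_add_floor_le_norm (ξ z : ℍ) :
    ξ.im / (ξ.im + 2) * (1 + |(⌊z.re - ξ.re⌋ : ℝ)|) ≤ ‖(z : ℂ) - conj (ξ : ℂ)‖ := by
  have hη := ξ.im_pos
  set w := (z : ℂ) - conj (ξ : ℂ)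
  have h1 : ξ.im ≤ ‖w‖ := by
    refine le_trans ?_ (Complex.abs_im_le_norm w)
    have : w.im = z.im + ξ.im := by simp [w]
    rw [this]
    have := z.im_pos
    exact le_trans (by linarith) (le_abs_self _)
  have h2 : |(⌊z.re - ξ.re⌋ : ℝ)| ≤ ‖w‖ + 1 := by
    have h3 := Complex.abs_re_le_norm w
    have : w.re = z.re - ξ.re := by simp [w]
    rw [this] at h3
    have h4 := Int.floor_le (z.re - ξ.re)
    have h5 := Int.lt_floor_add_one (z.re - ξ.re)
    rw [abs_le] at h3 ⊢
    constructor <;> linarith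
  -- With η = Im ξ and N the floor: η(1 + |N|) ≤ η‖w‖ + 2η ≤ (η + 2)‖w‖, by `h2` and `h1` in turn.
  rw [div_mul_eq_mul_div, div_le_iff₀ (by positivity)]
  nlinarith

lemma summable_one_add_abs_rpow {k : ℝ} (hk : 1 < k) :
    Summable fun n : ℤ => (1 + |(n : ℝ)|) ^ (-k) := by
  have h' : Summable fun n : ℕ => (1 + (n : ℝ)) ^ (-k) := by
    refine ((summable_nat_add_iff 1).2 (Real.summable_one_div_nat_rpow.2 hk)).congr fun n => ?_
    rw [Real.rpow_neg (by positivity)]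
    push_cast
    rw [one_div, add_comm]
  refine Summable.of_nat_of_neg ?_ ?_ <;> simpa using h'

lemma rpow_neg_norm_linForm_base_le {k : ℝ} (hk : 0 ≤ k) (ξ : ℍ) (γ : SL(2, ℤ)) :
    ‖linForm ξ γ ξ‖ ^ (-k) ≤ (EisensteinSeries.r ξ ^ (-k) * ‖![γ 1 0, γ 1 1]‖ ^ (-k)) *
      ((ξ.im / (ξ.im + 2)) ^ (-k) * (1 + |(⌊(γ • ξ).re - ξ.re⌋ : ℝ)|) ^ (-k)) := by
  have hη := ξ.im_pos
  have h1 := EisensteinSeries.summand_bound ξ hk ![γ 1 0, γ 1 1]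
  rw [linForm, norm_mul, Real.mul_rpow (norm_nonneg _) (norm_nonneg _)]
  refine mul_le_mul h1 ?_ (Real.rpow_nonneg (norm_nonneg _) _)
    ((Real.rpow_nonneg (norm_nonneg _) _).trans h1)
  have hc : 0 < ξ.im / (ξ.im + 2) := by positivity
  have hc' : 0 < 1 + |(⌊(γ • ξ).re - ξ.re⌋ : ℝ)| :=
    add_pos_of_pos_of_nonneg one_pos (abs_nonneg _)
  rw [← Real.mul_rpow hc.le hc'.le]
  exact Real.rpow_le_rpow_of_nonpos (mul_pos hc hc') (mul_one_add_floor_le_norm ξ (γ • ξ))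
    (neg_nonpos.2 hk)

/-- The map γ ↦ ((c, d), ⌊Re γξ - Re ξ⌋) is injective, and |L_γ(ξ)| = |cξ + d| |γξ - ξ̄| is bounded
below by a product of functions of the two coordinates. The sum is thus dominated by an
Eisenstein-type series over ℤ², which needs k > 2, times a series over ℤ, which needs only k > 1. -/
lemma summable_norm_linForm_base {k : ℝ} (hk : 2 < k) (ξ : ℍ) :
    Summable fun γ : SL(2, ℤ) => ‖linForm ξ γ ξ‖ ^ (-k) := by
  have hk0 : 0 ≤ k := by linarith
  have hη := ξ.im_pos
  have hg := Summable.mul_of_nonneg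
    ((EisensteinSeries.summable_one_div_norm_rpow hk).mul_left (EisensteinSeries.r ξ ^ (-k)))
    ((summable_one_add_abs_rpow (by linarith : 1 < k)).mul_left ((ξ.im / (ξ.im + 2)) ^ (-k)))
    (fun _ => mul_nonneg (Real.rpow_nonneg (EisensteinSeries.r_pos ξ).le _)
      (Real.rpow_nonneg (norm_nonneg _) _))
    (fun _ => by positivity)
  let e : SL(2, ℤ) → (Fin 2 → ℤ) × ℤ := fun γ => (![γ 1 0, γ 1 1], ⌊(γ • ξ).re - ξ.re⌋)
  have he : Function.Injective e := by
    intro γ γ' h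
    simp only [e, Prod.mk.injEq] at h
    have h0 : γ 1 0 = γ' 1 0 := by simpa using congrFun h.1 0
    have h1 : γ 1 1 = γ' 1 1 := by simpa using congrFun h.1 1
    exact eq_of_bottom_row_eq_of_floor_eq h0 h1 ξ ξ.re h.2
  have hge := hg.comp_injective he
  refine Summable.of_nonneg_of_le (fun _ => Real.rpow_nonneg (norm_nonneg _) _) ?_ hge
  intro γ
  simp only [Function.comp_apply, e]
  exact rpow_neg_norm_linForm_base_le hk0 ξ γ

lemma summable_norm_linForm {k : ℝ} (hk : 2 < k) (ξ τ : ℍ) :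
    Summable fun γ : SL(2, ℤ) => ‖linForm ξ γ τ‖ ^ (-k) :=
  Summable.of_nonneg_of_le (fun _ => by positivity)
    (fun γ => rpow_neg_norm_linForm_le (by linarith) ξ γ τ)
    ((summable_norm_linForm_base hk ξ).mul_left _)

/-- The series `∑_γ |(a τ + b) - ξ̄ (c τ + d)|^{-k}` over `SL₂(ℤ)`. -/
def majorant (k : ℝ) (ξ τ : ℍ) : ℝ := ∑' γ : SL(2, ℤ), ‖linForm ξ γ τ‖ ^ (-k)

lemma linForm_T_zpow_smul (ξ τ : ℍ) (γ : SL(2, ℤ)) (n : ℤ) :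
    linForm ξ γ (ModularGroup.T ^ n • τ) = linForm ξ (γ * ModularGroup.T ^ n) τ := by
  rw [linForm, linForm, jFactor_mul, jFactor_T_zpow, mul_one, mul_smul]

/-- Translating τ only permutes the summands, since the sum runs over the whole group. This reduces
the limit at i∞ to a vertical strip. -/
lemma majorant_T_zpow_smul (k : ℝ) (ξ τ : ℍ) (n : ℤ) :
    majorant k ξ (ModularGroup.T ^ n • τ) = majorant k ξ τ := by
  simp only [majorant, linForm_T_zpow_smul]
  exact (Equiv.mulRight (ModularGroup.T ^ n)).tsum_eq fun γ => ‖linForm ξ γ τ‖ ^ (-k)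

/-- Dominated convergence: each term is at most (|A| Im τ)^{-k}, where A ≠ 0 is the slope. The
restriction to a strip is what makes the comparison factor with the base point ξ bounded. -/
lemma tendsto_majorant_strip {k : ℝ} (hk : 2 < k) (ξ : ℍ) :
    Tendsto (majorant k ξ) (UpperHalfPlane.atImInfty ⊓ 𝓟 {τ | |τ.re| ≤ 1}) (𝓝 0) := by
  have hev : ∀ᶠ τ : ℍ in UpperHalfPlane.atImInfty ⊓ 𝓟 {τ | |τ.re| ≤ 1}, 1 ≤ τ.im ∧ |τ.re| ≤ 1 :=
    eventually_inf_principal.2 <| by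
      filter_upwards [tendsto_comap.eventually (eventually_ge_atTop (1 : ℝ))] with τ h h'
      exact ⟨h, h'⟩
  rw [← tsum_zero (α := ℝ) (β := SL(2, ℤ))]
  refine tendsto_tsum_of_dominated_convergence
    -- For |Re τ| ≤ 1 ≤ Im τ one has 1 + |τ - ξ| / Im τ ≤ 3 + |ξ|.
    (bound := fun γ => (3 + ‖(ξ : ℂ)‖) ^ k * ‖linForm ξ γ ξ‖ ^ (-k))
    ((summable_norm_linForm_base hk ξ).mul_left _) (fun γ => ?_) ?_
  · have hA : 0 < ‖linSlope ξ γ‖ := norm_pos_iff.2 (linSlope_ne_zero ξ γ)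
    have h1 : Tendsto (fun τ : ℍ => ‖linSlope ξ γ‖ * τ.im) UpperHalfPlane.atImInfty atTop :=
      tendsto_comap.const_mul_atTop hA
    have h2 : Tendsto (fun τ : ℍ => (‖linSlope ξ γ‖ * τ.im) ^ (-k))
        (UpperHalfPlane.atImInfty ⊓ 𝓟 {τ | |τ.re| ≤ 1}) (𝓝 0) :=
      ((tendsto_rpow_neg_atTop (by linarith)).comp h1).mono_left inf_le_left
    refine squeeze_zero (fun _ => by positivity) (fun τ => ?_) h2
    exact Real.rpow_le_rpow_of_nonpos (mul_pos hA τ.im_pos) (norm_linSlope_mul_im_le ξ γ τ)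
      (by linarith)
  · filter_upwards [hev] with τ hτ γ
    rw [Real.norm_of_nonneg (by positivity)]
    refine (rpow_neg_norm_linForm_le (by linarith) ξ γ τ).trans ?_
    have hτ0 := τ.im_pos
    refine mul_le_mul_of_nonneg_right (Real.rpow_le_rpow (by positivity) ?_ (by linarith))
      (by positivity)
    have h1 : ‖(τ : ℂ) - ξ‖ ≤ 1 + τ.im + ‖(ξ : ℂ)‖ := by
      refine (norm_sub_le _ _).trans ?_
      have h2 := Complex.norm_le_abs_re_add_abs_im (τ : ℂ)
      rw [UpperHalfPlane.coe_re, UpperHalfPlane.coe_im, abs_of_pos hτ0] at h2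
      linarith [hτ.2]
    have h3 : ‖(τ : ℂ) - ξ‖ / τ.im ≤ 2 + ‖(ξ : ℂ)‖ := by
      rw [div_le_iff₀ hτ0]
      nlinarith [norm_nonneg (ξ : ℂ), hτ.1]
    linarith

lemma tendsto_majorant {k : ℝ} (hk : 2 < k) (ξ : ℍ) :
    Tendsto (majorant k ξ) UpperHalfPlane.atImInfty (𝓝 0) := by
  refine tendsto_order.2 ⟨fun a ha => Eventually.of_forall fun τ =>
    lt_of_lt_of_le ha (tsum_nonneg fun _ => by positivity), fun a ha => ?_⟩
  have h := (tendsto_order.1 (tendsto_majorant_strip hk ξ)).2 a ha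
  rw [eventually_inf_principal, Filter.Eventually, UpperHalfPlane.atImInfty_mem] at h
  obtain ⟨A, hA⟩ := h
  refine UpperHalfPlane.atImInfty_mem _ |>.2 ⟨A, fun τ hτ => ?_⟩
  change majorant k ξ τ < a
  rw [← majorant_T_zpow_smul k ξ τ (-⌊τ.re⌋)]
  refine hA _ (by rwa [ModularGroup.im_T_zpow_smul]) ?_
  change |(ModularGroup.T ^ (-⌊τ.re⌋) • τ).re| ≤ 1
  rw [ModularGroup.re_T_zpow_smul, Int.cast_neg, abs_le]
  have h4 := Int.floor_le τ.re
  have h5 := Int.lt_floor_add_one τ.re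
  constructor <;> linarith

end Majorant

/-! ### Holomorphy of series, of slash translates and of the seed -/

section Holomorphy

open Filter Topology

lemma mdifferentiable_tsum {ι : Type*} {f : ι → ℍ → ℂ}
    (hf : ∀ i, MDifferentiable 𝓘(ℂ) 𝓘(ℂ) (f i))
    (hb : ∀ K : Set ℍ, IsCompact K → ∃ u : ι → ℝ, Summable u ∧ ∀ i, ∀ τ ∈ K, ‖f i τ‖ ≤ u i) :
    MDifferentiable 𝓘(ℂ) 𝓘(ℂ) fun τ => ∑' i, f i τ := by
  rw [UpperHalfPlane.mdifferentiable_iff]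
  have hU : IsOpen {z : ℂ | 0 < z.im} := UpperHalfPlane.isOpen_upperHalfPlaneSet
  have h : TendstoLocallyUniformlyOn
      (fun (s : Finset ι) (z : ℂ) => ∑ i ∈ s, f i (UpperHalfPlane.ofComplex z))
      ((fun τ => ∑' i, f i τ) ∘ UpperHalfPlane.ofComplex) atTop {z : ℂ | 0 < z.im} := by
    rw [tendstoLocallyUniformlyOn_iff_forall_isCompact hU]
    intro K hKU hK
    have hc : ContinuousOn UpperHalfPlane.ofComplex K := fun z hz =>
      (UpperHalfPlane.contMDiffAt_ofComplex (n := 0) (hKU hz)).continuousAt.continuousWithinAt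
    obtain ⟨u, hu, hfu⟩ := hb _ (hK.image_of_continuousOn hc)
    exact tendstoUniformlyOn_tsum (f := fun i z => f i (UpperHalfPlane.ofComplex z)) hu
      fun i z hz => hfu i _ (Set.mem_image_of_mem _ hz)
  refine h.differentiableOn (Eventually.of_forall fun s => ?_) hU
  exact DifferentiableOn.fun_sum fun i _ => UpperHalfPlane.mdifferentiable_iff.1 (hf i)

/-- If c ≠ 0 then cτ + d is never real and so avoids the branch cut. If c = 0 the base is the
constant d, possibly on the cut, but then the function is constant. -/
lemma mdifferentiable_jFactor_cpow (γ : SL(2, ℤ)) (s : ℂ) :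
    MDifferentiable 𝓘(ℂ) 𝓘(ℂ) fun τ => jFactor γ τ ^ s := by
  by_cases hc : γ 1 0 = 0
  · have : (fun τ => jFactor γ τ ^ s) = fun _ => (γ 1 1 : ℂ) ^ s := by
      funext τ; simp [jFactor, hc]
    rw [this]
    exact mdifferentiable_const
  · rw [UpperHalfPlane.mdifferentiable_iff]
    have h : DifferentiableOn ℂ (fun z : ℂ => ((γ 1 0 : ℂ) * z + (γ 1 1 : ℂ)) ^ s)
        {z : ℂ | 0 < z.im} := by
      refine DifferentiableOn.cpow_const (by fun_prop) fun z hz => ?_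
      rw [Complex.mem_slitPlane_iff]
      right
      have hz' : z.im ≠ 0 := ne_of_gt hz
      simpa using ⟨hc, hz'⟩
    refine h.congr fun z hz => ?_
    simp [jFactor, UpperHalfPlane.ofComplex_apply_of_im_pos hz]

lemma mdifferentiable_slash {k : ℝ} {v : SL(2, ℤ) → ℂ} {f : ℍ → ℂ}
    (hf : MDifferentiable 𝓘(ℂ) 𝓘(ℂ) f) (γ : SL(2, ℤ)) :
    MDifferentiable 𝓘(ℂ) 𝓘(ℂ) (slash k v f γ) := by
  have h1 : MDifferentiable 𝓘(ℂ) 𝓘(ℂ) fun τ : ℍ => γ • τ :=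
    UpperHalfPlane.mdifferentiable_smul (g := (γ : GL (Fin 2) ℝ)) (by simp)
  have h2 : MDifferentiable 𝓘(ℂ) 𝓘(ℂ) fun τ : ℍ => f (γ • τ) := hf.comp h1
  exact (mdifferentiable_const.mul (mdifferentiable_jFactor_cpow γ _)).smul h2

/-- The scalar factor of `ellipticSeed`. -/
def scalarSeed (k : ℝ) (ν : ℕ) (ξ τ : ℍ) : ℂ :=
  ((τ : ℂ) - (ξ : ℂ)) ^ ν / ((τ : ℂ) - conj (ξ : ℂ)) ^ ((ν : ℂ) + (k : ℂ))

lemma sub_conj_im (ξ τ : ℍ) : ((τ : ℂ) - conj (ξ : ℂ)).im = τ.im + ξ.im := by simp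

lemma sub_conj_mem_slitPlane (ξ τ : ℍ) : (τ : ℂ) - conj (ξ : ℂ) ∈ Complex.slitPlane := by
  rw [Complex.mem_slitPlane_iff, sub_conj_im]
  exact Or.inr (add_pos τ.im_pos ξ.im_pos).ne'

lemma sub_conj_ne_zero (ξ τ : ℍ) : (τ : ℂ) - conj (ξ : ℂ) ≠ 0 :=
  Complex.slitPlane_ne_zero (sub_conj_mem_slitPlane ξ τ)

lemma mdifferentiable_scalarSeed (k : ℝ) (ν : ℕ) (ξ : ℍ) :
    MDifferentiable 𝓘(ℂ) 𝓘(ℂ) (scalarSeed k ν ξ) := by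
  rw [UpperHalfPlane.mdifferentiable_iff]
  have h : DifferentiableOn ℂ (fun z : ℂ =>
      (z - (ξ : ℂ)) ^ ν / (z - conj (ξ : ℂ)) ^ ((ν : ℂ) + (k : ℂ))) {z : ℂ | 0 < z.im} := by
    refine DifferentiableOn.div (by fun_prop) ?_ ?_
    · exact DifferentiableOn.cpow_const (by fun_prop) fun z hz =>
        sub_conj_mem_slitPlane ξ ⟨z, hz⟩
    · intro z hz h0
      exact sub_conj_ne_zero ξ ⟨z, hz⟩ ((Complex.cpow_eq_zero_iff _ _).1 h0).1
  refine h.congr fun z hz => ?_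
  simp [scalarSeed, UpperHalfPlane.ofComplex_apply_of_im_pos hz]

end Holomorphy

/-! ### From periodicity and vanishing at i∞ to a Fourier expansion -/

section Fourier

open Filter Topology

lemma hasFourierExpansionFrom_one {f : ℍ → ℂ} (hf : MDifferentiable 𝓘(ℂ) 𝓘(ℂ) f) {L : ℕ}
    (hL : 0 < L) (hper : ∀ τ, f (ModularGroup.T ^ L • τ) = f τ)
    (h0 : Tendsto f UpperHalfPlane.atImInfty (𝓝 0)) : HasFourierExpansionFrom 1 f := by
  have hLr : (0 : ℝ) < L := by exact_mod_cast hL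
  have hp : Function.Periodic (f ∘ UpperHalfPlane.ofComplex) (L : ℝ) := by
    intro w
    by_cases hw : 0 < w.im
    · have hw' : 0 < (w + ((L : ℝ) : ℂ)).im := by simpa using hw
      simp only [Function.comp_apply, UpperHalfPlane.ofComplex_apply_of_im_pos hw',
        UpperHalfPlane.ofComplex_apply_of_im_pos hw]
      rw [← hper ⟨w, hw⟩]
      congr 1
      apply UpperHalfPlane.ext
      rw [coe_T_pow_smul]
      simp
    -- Outside the upper half-plane `ofComplex` takes a constant default value, so periodicity is
    -- trivial there.
    · have hw1 : w.im ≤ 0 := not_lt.1 hw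
      have hw' : (w + ((L : ℝ) : ℂ)).im ≤ 0 := by simpa using hw1
      simp only [Function.comp_apply, UpperHalfPlane.ofComplex_apply_of_im_nonpos hw1,
        UpperHalfPlane.ofComplex_apply_of_im_nonpos hw']
  have hz : UpperHalfPlane.IsZeroAtImInfty f := h0
  have hb := hz.isBoundedAtImInfty
  have hcoeff : (UpperHalfPlane.qExpansion (L : ℝ) f).coeff 0 = 0 := by
    rw [UpperHalfPlane.qExpansion_coeff, iteratedDeriv_zero, hz.cuspFunction_apply_zero hLr,
      mul_zero]
  refine ⟨L, hL, fun m => (UpperHalfPlane.qExpansion (L : ℝ) f).coeff (m + 1), fun τ => ?_⟩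
  have h := UpperHalfPlane.hasSum_qExpansion hLr hp hf hb τ
  -- The constant coefficient vanishes, so the expansion is re-indexed to start at exponent 1.
  rw [← hasSum_nat_add_iff' 1] at h
  simp only [Finset.range_one, Finset.sum_singleton, hcoeff, zero_smul, sub_zero] at h
  refine Eq.subst (motive := fun g => HasSum g (f τ)) (funext fun m => ?_) h
  rw [smul_eq_mul, Function.Periodic.qParam, ← Complex.exp_nat_mul]
  congr 2
  push_cast
  ring

end Fourier

/-! ### Periodicity of the slash translates of a form -/

section Periodicity

variable {p : ℕ} {k : ℝ} {v : SL(2, ℤ) → ℂ} {Γ : Subgroup SL(2, ℤ)} {ρ : Γ →* GL (Fin p) ℂ}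

lemma slash_act (A : Matrix (Fin p) (Fin p) ℂ) (F : ℍ → Vec p) (γ : SL(2, ℤ)) (τ : ℍ) :
    slash k v (fun τ => act A (F τ)) γ τ = act A (slash k v F γ τ) := by
  simp only [slash, act_smul]

lemma slash_T_pow_smul (hv : IsMultiplierSystem k v) {E : Type*} [AddCommGroup E] [Module ℂ E]
    (F : ℍ → E) (M : ℕ) (τ : ℍ) :
    slash k v F (ModularGroup.T ^ M) τ = (v ModularGroup.T ^ M)⁻¹ • F (ModularGroup.T ^ M • τ) := by
  rw [slash, jFactor_T_pow, hv.map_T_pow, Complex.one_cpow, mul_one]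

/-- Finite index puts σT^Mσ⁻¹ in Γ for some M ≥ 1. Then τ ↦ τ + M multiplies F|σ by v(T)^M
ρ(σT^Mσ⁻¹), which is precisely the matrix that normality requires to have finite order N; hence MN
is a period. -/
lemma exists_period [Γ.FiniteIndex] (hv : IsMultiplierSystem k v) (hΓ : -1 ∈ Γ)
    (hρ : IsNormalRep v hΓ ρ) {F : ℍ → Vec p}
    (hF : ∀ (γ : Γ) (τ : ℍ), slash k v F γ τ = act (ρ γ : Matrix (Fin p) (Fin p) ℂ) (F τ))
    (σ : SL(2, ℤ)) :
    ∃ L : ℕ, 0 < L ∧ ∀ τ, slash k v F σ (ModularGroup.T ^ L • τ) = slash k v F σ τ := by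
  obtain ⟨M, hM, -, hmem⟩ := Γ.exists_pow_mem_of_index_ne_zero
    Subgroup.FiniteIndex.index_ne_zero (σ * ModularGroup.T * σ⁻¹)
  rw [conj_pow] at hmem
  obtain ⟨N, hN, hpow⟩ := hρ.exists_pow σ M hM hmem
  set R : Matrix (Fin p) (Fin p) ℂ := Complex.exp (2 * Real.pi * Complex.I * kappa v * (M : ℂ)) •
    (ρ ⟨σ * ModularGroup.T ^ M * σ⁻¹, hmem⟩ : Matrix (Fin p) (Fin p) ℂ) with hR
  have hstep : ∀ τ, slash k v F σ (ModularGroup.T ^ M • τ) = act R (slash k v F σ τ) := by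
    intro τ
    have h1 : slash k v F (σ * ModularGroup.T ^ M) τ =
        act (ρ ⟨σ * ModularGroup.T ^ M * σ⁻¹, hmem⟩ : Matrix (Fin p) (Fin p) ℂ)
          (slash k v F σ τ) := by
      have : σ * ModularGroup.T ^ M = (σ * ModularGroup.T ^ M * σ⁻¹) * σ := by group
      conv_lhs => rw [this, slash_mul hv]
      have h2 : slash k v F (σ * ModularGroup.T ^ M * σ⁻¹) = fun τ =>
          act (ρ ⟨σ * ModularGroup.T ^ M * σ⁻¹, hmem⟩ : Matrix (Fin p) (Fin p) ℂ) (F τ) :=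
        funext fun τ => hF ⟨_, hmem⟩ τ
      rw [h2, slash_act]
    rw [slash_mul hv, slash_T_pow_smul hv] at h1
    have hv0 : v ModularGroup.T ^ M ≠ 0 := pow_ne_zero _ (hv.ne_zero _)
    rw [inv_smul_eq_iff₀ hv0] at h1
    rw [h1, hR, mul_comm, Complex.exp_nat_mul, exp_kappa hv]
    simp [act, Matrix.smul_mulVec]
  refine ⟨M * N, Nat.mul_pos hM hN, ?_⟩
  have hiter : ∀ (n : ℕ) (τ : ℍ),
      slash k v F σ (ModularGroup.T ^ (M * n) • τ) = act (R ^ n) (slash k v F σ τ) := by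
    intro n
    induction n with
    | zero => intro τ; simp [act_one]
    | succ n ih =>
      intro τ
      rw [Nat.mul_succ, pow_add, mul_smul, ih, hstep, pow_succ, act_mul]
  intro τ
  rw [hiter, hpow, act_one]

end Periodicity

/-! ### The elliptic Poincaré series is a cuspidal form -/

section Elliptic

open Filter Topology

variable {p : ℕ} {k : ℝ} {v : SL(2, ℤ) → ℂ} {Γ : Subgroup SL(2, ℤ)} {ρ : Γ →* GL (Fin p) ℂ}

lemma ellipticSeed_eq (ν : ℕ) (ξ : ℍ) (u : Vec p) :
    ellipticSeed k ν ξ u = fun τ => scalarSeed k ν ξ τ • u := rfl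

lemma norm_sub_le_norm_sub_conj (ξ τ : ℍ) :
    ‖(τ : ℂ) - (ξ : ℂ)‖ ≤ ‖(τ : ℂ) - conj (ξ : ℂ)‖ := by
  rw [← sq_le_sq₀ (norm_nonneg _) (norm_nonneg _), ← Complex.normSq_eq_norm_sq,
    ← Complex.normSq_eq_norm_sq, Complex.normSq_apply, Complex.normSq_apply]
  have h1 := ξ.im_pos
  have h2 := τ.im_pos
  simp
  nlinarith [mul_pos h1 h2]

lemma norm_scalarSeed (k : ℝ) (ν : ℕ) (ξ τ : ℍ) :
    ‖scalarSeed k ν ξ τ‖ = ‖((τ : ℂ) - ξ) / ((τ : ℂ) - conj (ξ : ℂ))‖ ^ ν *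
      ‖(τ : ℂ) - conj (ξ : ℂ)‖ ^ (-k) := by
  have h0 : 0 < ‖(τ : ℂ) - conj (ξ : ℂ)‖ := norm_pos_iff.2 (sub_conj_ne_zero ξ τ)
  rw [scalarSeed, norm_div, norm_pow, norm_div, div_pow,
    show (ν : ℂ) + (k : ℂ) = ((ν + k : ℝ) : ℂ) by push_cast; rfl, Complex.norm_cpow_real,
    Real.rpow_add h0, Real.rpow_natCast, Real.rpow_neg h0.le]
  field_simp

lemma norm_scalarSeed_le (k : ℝ) (ν : ℕ) (ξ τ : ℍ) :
    ‖scalarSeed k ν ξ τ‖ ≤ ‖(τ : ℂ) - conj (ξ : ℂ)‖ ^ (-k) := by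
  rw [norm_scalarSeed]
  refine mul_le_of_le_one_left (by positivity) (pow_le_one₀ (norm_nonneg _) ?_)
  rw [norm_div]
  exact div_le_one_of_le₀ (norm_sub_le_norm_sub_conj ξ τ) (norm_nonneg _)

lemma norm_slashRep_ellipticSeed_le (hv : IsMultiplierSystem k v) (hρ : IsUnitaryRep ρ) (ν : ℕ)
    (ξ : ℍ) (u : Vec p) (γ : Γ) (τ : ℍ) :
    ‖slashRep k v ρ (ellipticSeed k ν ξ u) γ τ‖ ≤ ‖u‖ * ‖linForm ξ γ τ‖ ^ (-k) := by
  rw [norm_slashRep hv hρ, ellipticSeed_eq, norm_smul, linForm, norm_mul,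
    Real.mul_rpow (norm_nonneg _) (norm_nonneg _)]
  have h := norm_scalarSeed_le k ν ξ ((γ : SL(2, ℤ)) • τ)
  calc _ ≤ ‖jFactor γ τ‖ ^ (-k) *
        (‖(((γ : SL(2, ℤ)) • τ : ℍ) : ℂ) - conj (ξ : ℂ)‖ ^ (-k) * ‖u‖) := by gcongr
    _ = _ := by ring

lemma injective_coe_out (Λ : Subgroup Γ) :
    Function.Injective fun q : RightCosets Λ => ((q.out : Γ) : SL(2, ℤ)) :=
  Subtype.val_injective.comp Quotient.out_injective

variable {hΓ : -1 ∈ Γ}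

lemma norm_ellipticTerm_le (hv : IsMultiplierSystem k v) (hρ : IsUnitaryRep ρ) (ν : ℕ)
    (ξ : ℍ) (u : Vec p) (q : RightCosets (negOneSubgroup hΓ)) (τ : ℍ) :
    ‖ellipticTerm k v hΓ ρ ν ξ u q τ‖ ≤ ‖u‖ * ‖linForm ξ (q.out : Γ) τ‖ ^ (-k) :=
  norm_slashRep_ellipticSeed_le hv hρ ν ξ u q.out τ

/-- The terms are compared with the convergent sum at the base point ξ; the comparison factor is
continuous in τ, hence bounded on K. -/
lemma exists_summable_bound_ellipticTerm (hk : 2 < k) (hv : IsMultiplierSystem k v)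
    (hρ : IsUnitaryRep ρ) (ν : ℕ) (ξ : ℍ) (u : Vec p) {K : Set ℍ} (hK : IsCompact K) :
    ∃ b : RightCosets (negOneSubgroup hΓ) → ℝ, Summable b ∧
      ∀ q, ∀ τ ∈ K, ‖ellipticTerm k v hΓ ρ ν ξ u q τ‖ ≤ b q := by
  have hc : Continuous fun τ : ℍ => (1 + ‖(τ : ℂ) - ξ‖ / τ.im) ^ k := by
    refine Continuous.rpow_const ?_ fun τ => Or.inr (by linarith)
    refine continuous_const.add (Continuous.div ?_ UpperHalfPlane.continuous_im
      fun τ => τ.im_pos.ne')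
    exact (UpperHalfPlane.continuous_coe.sub continuous_const).norm
  obtain ⟨C, hC⟩ := hK.exists_bound_of_continuousOn hc.continuousOn
  refine ⟨fun q => ‖u‖ * (C * ‖linForm ξ (q.out : Γ) ξ‖ ^ (-k)),
    (((summable_norm_linForm_base hk ξ).comp_injective
      (injective_coe_out (negOneSubgroup hΓ))).mul_left C).mul_left _, fun q τ hτ => ?_⟩
  refine (norm_ellipticTerm_le hv hρ ν ξ u q τ).trans ?_
  refine mul_le_mul_of_nonneg_left ?_ (norm_nonneg u)
  refine (rpow_neg_norm_linForm_le (by linarith) ξ _ τ).trans ?_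
  exact mul_le_mul_of_nonneg_right ((le_abs_self _).trans (hC τ hτ))
    (Real.rpow_nonneg (norm_nonneg _) _)

lemma summable_ellipticTerm (hk : 2 < k) (hv : IsMultiplierSystem k v)
    (hρ : IsUnitaryRep ρ) (ν : ℕ) (ξ : ℍ) (u : Vec p) (τ : ℍ) :
    Summable fun q => ellipticTerm k v hΓ ρ ν ξ u q τ := by
  obtain ⟨b, hb, h⟩ := exists_summable_bound_ellipticTerm (hΓ := hΓ) hk hv hρ ν ξ u
    (isCompact_singleton (x := τ))
  exact Summable.of_norm_bounded hb fun q => h q τ rfl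

lemma hasSumUniformlyOn_ellipticTerm (hk : 2 < k) (hv : IsMultiplierSystem k v)
    (hρ : IsUnitaryRep ρ) (ν : ℕ) (ξ : ℍ) (u : Vec p) {K : Set ℍ} (hK : IsCompact K) :
    SummableUniformlyOn (fun q τ => ‖ellipticTerm k v hΓ ρ ν ξ u q τ‖) K ∧
      HasSumUniformlyOn (ellipticTerm k v hΓ ρ ν ξ u) (ellipticSeries k v hΓ ρ ν ξ u) K := by
  obtain ⟨b, hb, h⟩ := exists_summable_bound_ellipticTerm (hΓ := hΓ) hk hv hρ ν ξ u hK
  exact ⟨(HasSumUniformlyOn.of_norm_le_summable hb fun q τ hτ => by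
    rw [norm_norm]; exact h q τ hτ).summableUniformlyOn,
    HasSumUniformlyOn.of_norm_le_summable hb h⟩

lemma ellipticSeries_apply (hk : 2 < k) (hv : IsMultiplierSystem k v)
    (hρ : IsUnitaryRep ρ) (ν : ℕ) (ξ : ℍ) (u : Vec p) (τ : ℍ) (i : Fin p) :
    ellipticSeries k v hΓ ρ ν ξ u τ i = ∑' q, ellipticTerm k v hΓ ρ ν ξ u q τ i :=
  (EuclideanSpace.proj (𝕜 := ℂ) i).map_tsum (summable_ellipticTerm hk hv hρ ν ξ u τ)

lemma mdifferentiable_slashRep_ellipticSeed (ν : ℕ) (ξ : ℍ) (u : Vec p) (γ : Γ) (i : Fin p) :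
    MDifferentiable 𝓘(ℂ) 𝓘(ℂ) fun τ => slashRep k v ρ (ellipticSeed k ν ξ u) γ τ i := by
  have h : (fun τ => slashRep k v ρ (ellipticSeed k ν ξ u) γ τ i) = fun τ =>
      slash k v (scalarSeed k ν ξ) γ τ * act ((ρ γ)⁻¹ : GL (Fin p) ℂ) u i := by
    funext τ
    simp only [slashRep, slash, ellipticSeed_eq, act_smul]
    simp [mul_assoc]
  rw [h]
  exact (mdifferentiable_slash (mdifferentiable_scalarSeed k ν ξ) γ).mul mdifferentiable_const

lemma mdifferentiable_ellipticSeries (hk : 2 < k) (hv : IsMultiplierSystem k v)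
    (hρ : IsUnitaryRep ρ) (ν : ℕ) (ξ : ℍ) (u : Vec p) (i : Fin p) :
    MDifferentiable 𝓘(ℂ) 𝓘(ℂ) fun τ => ellipticSeries k v hΓ ρ ν ξ u τ i := by
  simp only [ellipticSeries_apply hk hv hρ]
  refine mdifferentiable_tsum (fun q => mdifferentiable_slashRep_ellipticSeed ν ξ u q.out i)
    fun K hK => ?_
  obtain ⟨b, hb, h⟩ := exists_summable_bound_ellipticTerm (hΓ := hΓ) hk hv hρ ν ξ u hK
  exact ⟨b, hb, fun q τ hτ => (PiLp.norm_apply_le _ i).trans (h q τ hτ)⟩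

/-- Right multiplication by `γ` on `Λ\Γ`. -/
def rightCosetsMulRight (Λ : Subgroup Γ) (γ : Γ) : RightCosets Λ ≃ RightCosets Λ :=
  Quotient.congr (Equiv.mulRight γ) fun a b => by
    simp [QuotientGroup.rightRel_apply, mul_assoc]

/-- Slashing by γ permutes the cosets by right multiplication; Λ-invariance of f makes the terms
independent of the representatives that this produces. -/
lemma slashRep_poincareSeries (hv : IsMultiplierSystem k v) (Λ : Subgroup Γ) (f : ℍ → Vec p)
    (hf : ∀ l ∈ Λ, slashRep k v ρ f l = f)
    (hs : ∀ τ, Summable fun q => poincareTerm k v ρ Λ f q τ) (γ : Γ) :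
    slashRep k v ρ (poincareSeries k v ρ Λ f) γ = poincareSeries k v ρ Λ f := by
  funext τ
  rw [slashRep, slash, poincareSeries, act_smul, act_eq_toEuclideanCLM,
    ContinuousLinearMap.map_tsum _ (hs _), ← tsum_const_smul'', poincareSeries,
    ← (rightCosetsMulRight Λ γ).tsum_eq fun q => poincareTerm k v ρ Λ f q τ]
  refine tsum_congr fun q => ?_
  have h1 : rightCosetsMulRight Λ γ q = Quotient.mk (QuotientGroup.rightRel Λ) (q.out * γ) := by
    conv_lhs => rw [← Quotient.out_eq q]
    rfl
  rw [h1, poincareTerm_mk hv ρ Λ f hf, slashRep_mul hv, ← act_eq_toEuclideanCLM, ← act_smul]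
  rfl

lemma slash_ellipticSeries (hk : 2 < k) (hv : IsMultiplierSystem k v)
    (hρ : IsUnitaryRep ρ) (hρ' : IsNormalRep v hΓ ρ) (ν : ℕ) (ξ : ℍ) (u : Vec p) (γ : Γ) (τ : ℍ) :
    slash k v (ellipticSeries k v hΓ ρ ν ξ u) γ τ =
      act (ρ γ : Matrix (Fin p) (Fin p) ℂ) (ellipticSeries k v hΓ ρ ν ξ u τ) := by
  have h := congrFun (slashRep_poincareSeries hv (negOneSubgroup hΓ) (ellipticSeed k ν ξ u)
    (slashRep_negOneSubgroup hv hΓ ρ hρ' _) (summable_ellipticTerm hk hv hρ ν ξ u) γ) τ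
  rw [ellipticSeries, ← h, slashRep, act_act_inv]

lemma linForm_mul_eq (ξ : ℍ) (γ σ : SL(2, ℤ)) (τ : ℍ) :
    linForm ξ (γ * σ) τ = jFactor σ τ * linForm ξ γ (σ • τ) := by
  rw [linForm, linForm, jFactor_mul, mul_smul]
  ring

/-- Slashing by σ replaces the representatives γ by γσ, which are still distinct elements of
`SL₂(ℤ)`. So one majorant, taken over the full modular group, controls the series at every cusp. -/
lemma norm_slash_ellipticSeries_le (hk : 2 < k) (hv : IsMultiplierSystem k v)
    (hρ : IsUnitaryRep ρ) (ν : ℕ) (ξ : ℍ) (u : Vec p) (σ : SL(2, ℤ)) (τ : ℍ) :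
    ‖slash k v (ellipticSeries k v hΓ ρ ν ξ u) σ τ‖ ≤ ‖u‖ * majorant k ξ τ := by
  have hi : Function.Injective
      fun q : RightCosets (negOneSubgroup hΓ) => ((q.out : Γ) : SL(2, ℤ)) * σ :=
    (mul_left_injective σ).comp (injective_coe_out _)
  have hs := summable_norm_linForm hk ξ τ
  have hsi := hs.comp_injective hi
  have h1 : ∀ q : RightCosets (negOneSubgroup hΓ),
      ‖jFactor σ τ‖ ^ (-k) * ‖ellipticTerm k v hΓ ρ ν ξ u q (σ • τ)‖ ≤
        ‖u‖ * ‖linForm ξ (((q.out : Γ) : SL(2, ℤ)) * σ) τ‖ ^ (-k) := by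
    intro q
    rw [linForm_mul_eq, norm_mul, Real.mul_rpow (norm_nonneg _) (norm_nonneg _)]
    calc _ ≤ ‖jFactor σ τ‖ ^ (-k) * (‖u‖ * ‖linForm ξ (q.out : Γ) (σ • τ)‖ ^ (-k)) := by
          gcongr; exact norm_ellipticTerm_le hv hρ ν ξ u q _
      _ = _ := by ring
  have h2 := Summable.of_nonneg_of_le (fun q => by positivity) h1 (hsi.mul_left ‖u‖)
  have h3 : Summable fun q => ‖ellipticTerm k v hΓ ρ ν ξ u q (σ • τ)‖ :=
    (summable_ellipticTerm hk hv hρ ν ξ u _).norm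
  rw [norm_slash hv]
  calc _ ≤ ‖jFactor σ τ‖ ^ (-k) * ∑' q, ‖ellipticTerm k v hΓ ρ ν ξ u q (σ • τ)‖ := by
        gcongr; exact norm_tsum_le_tsum_norm h3
    _ = ∑' q, ‖jFactor σ τ‖ ^ (-k) * ‖ellipticTerm k v hΓ ρ ν ξ u q (σ • τ)‖ := tsum_mul_left.symm
    _ ≤ ∑' q : RightCosets (negOneSubgroup hΓ),
        ‖u‖ * ‖linForm ξ (((q.out : Γ) : SL(2, ℤ)) * σ) τ‖ ^ (-k) :=
      h2.tsum_le_tsum h1 (hsi.mul_left ‖u‖)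
    _ = ‖u‖ * ∑' q : RightCosets (negOneSubgroup hΓ),
        ‖linForm ξ (((q.out : Γ) : SL(2, ℤ)) * σ) τ‖ ^ (-k) := tsum_mul_left
    _ ≤ _ := by
      refine mul_le_mul_of_nonneg_left ?_ (norm_nonneg u)
      exact hsi.tsum_le_tsum_of_inj _ hi (fun _ _ => Real.rpow_nonneg (norm_nonneg _) _)
        (fun _ => le_rfl) hs

lemma slash_apply (F : ℍ → Vec p) (i : Fin p) (σ : SL(2, ℤ)) (τ : ℍ) :
    slash k v (fun τ => F τ i) σ τ = slash k v F σ τ i := rfl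

lemma hasFourierExpansionFrom_ellipticSeries [Γ.FiniteIndex] (hk : 2 < k)
    (hv : IsMultiplierSystem k v) (hρ : IsUnitaryRep ρ) (hρ' : IsNormalRep v hΓ ρ) (ν : ℕ) (ξ : ℍ)
    (u : Vec p) (i : Fin p) (σ : SL(2, ℤ)) :
    HasFourierExpansionFrom 1 (slash k v (fun τ => ellipticSeries k v hΓ ρ ν ξ u τ i) σ) := by
  obtain ⟨L, hL, hper⟩ := exists_period hv hΓ hρ' (slash_ellipticSeries hk hv hρ hρ' ν ξ u) σ
  refine hasFourierExpansionFrom_one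
    (mdifferentiable_slash (mdifferentiable_ellipticSeries hk hv hρ ν ξ u i) σ) hL
    (fun τ => ?_) ?_
  · rw [slash_apply, slash_apply, hper]
  · have h := (tendsto_majorant hk ξ).const_mul ‖u‖
    rw [mul_zero] at h
    refine squeeze_zero_norm (fun τ => ?_) h
    rw [slash_apply]
    exact (PiLp.norm_apply_le _ i).trans (norm_slash_ellipticSeries_le hk hv hρ ν ξ u σ τ)

theorem isCuspidalVVMF_ellipticSeries [Γ.FiniteIndex] (hk : 2 < k)
    (hv : IsMultiplierSystem k v) (hρ : IsUnitaryRep ρ) (hρ' : IsNormalRep v hΓ ρ) (ν : ℕ) (ξ : ℍ)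
    (u : Vec p) : IsCuspidalVVMF k v ρ (ellipticSeries k v hΓ ρ ν ξ u) := by
  have hF : ∀ i, IsFormF k v fun τ => ellipticSeries k v hΓ ρ ν ξ u τ i := fun i =>
    ⟨mdifferentiable_ellipticSeries hk hv hρ ν ξ u i, fun σ =>
      ⟨1, hasFourierExpansionFrom_ellipticSeries hk hv hρ hρ' ν ξ u i σ⟩⟩
  exact ⟨⟨hF, slash_ellipticSeries hk hv hρ hρ' ν ξ u⟩, fun i => ⟨hF i, fun σ =>
    ⟨1, one_pos, hasFourierExpansionFrom_ellipticSeries hk hv hρ hρ' ν ξ u i σ⟩⟩⟩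

end Elliptic

/-! ### The Cayley transform centred at ξ -/

section Disc

/-- The Cayley transform from the unit disc to `ℍ` that maps `0` to `ξ`. -/
def fromDisc (ξ : ℍ) (w : ℂ) : ℂ := ((ξ : ℂ) - conj (ξ : ℂ) * w) / (1 - w)

/-- The Cayley transform from `ℍ` to the unit disc that maps `ξ` to `0`. -/
def toDisc (ξ : ℍ) (z : ℂ) : ℂ := (z - ξ) / (z - conj (ξ : ℂ))

lemma one_sub_ne_zero {w : ℂ} (hw : w ∈ Metric.ball (0 : ℂ) 1) : 1 - w ≠ 0 := by
  intro h
  rw [sub_eq_zero] at h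
  simp [← h] at hw

lemma one_sub_norm_sq_pos {w : ℂ} (hw : w ∈ Metric.ball (0 : ℂ) 1) : 0 < 1 - ‖w‖ ^ 2 := by
  rw [mem_ball_zero_iff] at hw
  nlinarith [norm_nonneg w]

lemma fromDisc_im (ξ : ℍ) {w : ℂ} (hw : w ∈ Metric.ball (0 : ℂ) 1) :
    (fromDisc ξ w).im = ξ.im * (1 - ‖w‖ ^ 2) / ‖1 - w‖ ^ 2 := by
  have h0 := one_sub_ne_zero hw
  have h : fromDisc ξ w = (((ξ : ℂ) - conj (ξ : ℂ) * w) * conj (1 - w)) / ((‖1 - w‖ ^ 2 : ℝ) : ℂ) := by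
    rw [← Complex.normSq_eq_norm_sq, ← Complex.mul_conj, fromDisc, mul_div_mul_right]
    exact (map_ne_zero _).2 h0
  rw [h, Complex.div_ofReal_im, ← Complex.normSq_eq_norm_sq w, Complex.normSq_apply]
  congr 1
  simp
  ring

lemma fromDisc_im_pos (ξ : ℍ) {w : ℂ} (hw : w ∈ Metric.ball (0 : ℂ) 1) :
    0 < (fromDisc ξ w).im := by
  rw [fromDisc_im ξ hw]
  have h1 := norm_pos_iff.2 (one_sub_ne_zero hw)
  have h2 := one_sub_norm_sq_pos hw
  have h3 := ξ.im_pos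
  positivity

lemma sub_conj_self (ξ : ℍ) : (ξ : ℂ) - conj (ξ : ℂ) = 2 * ξ.im * Complex.I := by
  rw [Complex.sub_conj, UpperHalfPlane.coe_im]
  push_cast; ring

lemma fromDisc_sub_conj (ξ : ℍ) {w : ℂ} (hw : w ∈ Metric.ball (0 : ℂ) 1) :
    fromDisc ξ w - conj (ξ : ℂ) = ((ξ : ℂ) - conj (ξ : ℂ)) / (1 - w) := by
  have h0 := one_sub_ne_zero hw
  rw [fromDisc]
  field_simp
  ring

lemma fromDisc_sub (ξ : ℍ) {w : ℂ} (hw : w ∈ Metric.ball (0 : ℂ) 1) :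
    fromDisc ξ w - ξ = ((ξ : ℂ) - conj (ξ : ℂ)) * w / (1 - w) := by
  have h0 := one_sub_ne_zero hw
  rw [fromDisc]
  field_simp
  ring

lemma toDisc_fromDisc (ξ : ℍ) {w : ℂ} (hw : w ∈ Metric.ball (0 : ℂ) 1) :
    toDisc ξ (fromDisc ξ w) = w := by
  have h0 := one_sub_ne_zero hw
  have h1 := sub_conj_ne_zero ξ ξ
  rw [toDisc, fromDisc_sub_conj ξ hw, fromDisc_sub ξ hw]
  field_simp

lemma fromDisc_toDisc (ξ τ : ℍ) : fromDisc ξ (toDisc ξ τ) = τ := by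
  have h0 := sub_conj_ne_zero ξ τ
  have h1 := sub_conj_ne_zero ξ ξ
  have h2 : 1 - toDisc ξ τ = ((ξ : ℂ) - conj (ξ : ℂ)) / ((τ : ℂ) - conj (ξ : ℂ)) := by
    rw [toDisc]; field_simp; ring
  rw [fromDisc, h2, toDisc]
  field_simp
  ring

lemma toDisc_mem_ball (ξ τ : ℍ) : toDisc ξ τ ∈ Metric.ball (0 : ℂ) 1 := by
  rw [mem_ball_zero_iff, toDisc, norm_div, div_lt_one (norm_pos_iff.2 (sub_conj_ne_zero ξ τ)),
    ← sq_lt_sq₀ (norm_nonneg _) (norm_nonneg _), ← Complex.normSq_eq_norm_sq,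
    ← Complex.normSq_eq_norm_sq, Complex.normSq_apply, Complex.normSq_apply]
  simp
  nlinarith [mul_pos ξ.im_pos τ.im_pos]

lemma image_fromDisc (ξ : ℍ) : fromDisc ξ '' Metric.ball (0 : ℂ) 1 = {z : ℂ | 0 < z.im} := by
  ext z
  constructor
  · rintro ⟨w, hw, rfl⟩
    exact fromDisc_im_pos ξ hw
  · intro hz
    exact ⟨toDisc ξ z, toDisc_mem_ball ξ ⟨z, hz⟩, fromDisc_toDisc ξ ⟨z, hz⟩⟩

lemma injOn_fromDisc (ξ : ℍ) : Set.InjOn (fromDisc ξ) (Metric.ball (0 : ℂ) 1) := by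
  intro w hw w' hw' h
  rw [← toDisc_fromDisc ξ hw, h, toDisc_fromDisc ξ hw']

lemma hasDerivAt_fromDisc (ξ : ℍ) {w : ℂ} (hw : w ∈ Metric.ball (0 : ℂ) 1) :
    HasDerivAt (fromDisc ξ) (((ξ : ℂ) - conj (ξ : ℂ)) / (1 - w) ^ 2) w := by
  have h0 := one_sub_ne_zero hw
  have h1 : HasDerivAt (fun w : ℂ => (ξ : ℂ) - conj (ξ : ℂ) * w) (-conj (ξ : ℂ)) w := by
    simpa using ((hasDerivAt_id w).const_mul (conj (ξ : ℂ))).const_sub (ξ : ℂ)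
  have h2 : HasDerivAt (fun w : ℂ => 1 - w) (-1) w := by
    simpa using (hasDerivAt_id w).const_sub (1 : ℂ)
  refine HasDerivAt.congr_deriv (h1.div h2 h0) ?_
  congr 1
  ring

/-- The Cayley transform as a map to `ℍ`. -/
def discPoint (ξ : ℍ) (w : ℂ) : ℍ := UpperHalfPlane.ofComplex (fromDisc ξ w)

lemma coe_discPoint (ξ : ℍ) {w : ℂ} (hw : w ∈ Metric.ball (0 : ℂ) 1) :
    (discPoint ξ w : ℂ) = fromDisc ξ w := by
  rw [discPoint, UpperHalfPlane.ofComplex_apply_of_im_pos (fromDisc_im_pos ξ hw)]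

lemma discPoint_toDisc (ξ τ : ℍ) : discPoint ξ (toDisc ξ τ) = τ := by
  rw [discPoint, fromDisc_toDisc, UpperHalfPlane.ofComplex_apply]

lemma discPoint_im (ξ : ℍ) {w : ℂ} (hw : w ∈ Metric.ball (0 : ℂ) 1) :
    (discPoint ξ w).im = ξ.im * (1 - ‖w‖ ^ 2) / ‖1 - w‖ ^ 2 := by
  rw [← fromDisc_im ξ hw, ← coe_discPoint ξ hw, UpperHalfPlane.coe_im]

lemma norm_discPoint_sub_conj (ξ : ℍ) {w : ℂ} (hw : w ∈ Metric.ball (0 : ℂ) 1) :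
    ‖(discPoint ξ w : ℂ) - conj (ξ : ℂ)‖ = 2 * ξ.im / ‖1 - w‖ := by
  rw [coe_discPoint ξ hw, fromDisc_sub_conj ξ hw, sub_conj_self, norm_div]
  have := ξ.im_pos
  simp [abs_of_pos this]

lemma differentiableOn_comp_discPoint (ξ : ℍ) {f : ℍ → ℂ} (hf : MDifferentiable 𝓘(ℂ) 𝓘(ℂ) f) :
    DifferentiableOn ℂ (fun w => f (discPoint ξ w)) (Metric.ball (0 : ℂ) 1) := by
  have h1 : DifferentiableOn ℂ (fromDisc ξ) (Metric.ball (0 : ℂ) 1) := fun w hw =>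
    (hasDerivAt_fromDisc ξ hw).differentiableAt.differentiableWithinAt
  exact (UpperHalfPlane.mdifferentiable_iff.1 hf).comp h1 fun w hw => fromDisc_im_pos ξ hw

end Disc

/-! ### The invariant measure in the disc coordinate -/

section Measure

variable {E : Type*} [NormedAddCommGroup E] [NormedSpace ℝ E]

lemma measurePreserving_coe :
    MeasurePreserving UpperHalfPlane.coe ((volume : Measure ℂ).comap UpperHalfPlane.coe)
      (volume.restrict {z : ℂ | 0 < z.im}) := by
  refine ⟨UpperHalfPlane.measurable_coe, ?_⟩
  rw [UpperHalfPlane.measurableEmbedding_coe.map_comap, UpperHalfPlane.range_coe]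

lemma measurable_density :
    Measurable fun z : ℍ => ((1 / NNReal.mk z.im z.im_pos.le : NNReal) ^ 2) := by
  have : Measurable fun z : ℍ => NNReal.mk z.im z.im_pos.le :=
    (UpperHalfPlane.continuous_im.subtype_mk _).measurable
  fun_prop

lemma integrable_uhp_iff (φ : ℍ → E) :
    Integrable φ ↔ IntegrableOn (fun z : ℂ => (1 / z.im ^ 2) • φ (UpperHalfPlane.ofComplex z))
      {z : ℂ | 0 < z.im} := by
  rw [UpperHalfPlane.volume_def, integrable_withDensity_iff_integrable_smul measurable_density,
    IntegrableOn, ← measurePreserving_coe.integrable_comp_emb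
      UpperHalfPlane.measurableEmbedding_coe]
  refine iff_of_eq (congrArg (fun g => Integrable g _) (funext fun τ => ?_))
  simp [NNReal.smul_def]

lemma integral_uhp_eq (φ : ℍ → E) :
    ∫ τ, φ τ = ∫ z in {z : ℂ | 0 < z.im}, (1 / z.im ^ 2) • φ (UpperHalfPlane.ofComplex z) := by
  rw [UpperHalfPlane.volume_def, integral_withDensity_eq_integral_smul measurable_density,
    ← measurePreserving_coe.integral_comp UpperHalfPlane.measurableEmbedding_coe]
  refine integral_congr_ae (Filter.Eventually.of_forall fun τ => ?_)
  simp [NNReal.smul_def]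

/-- The derivative of `fromDisc` as a real linear map. -/
def fromDiscDeriv (ξ : ℍ) (w : ℂ) : ℂ →L[ℝ] ℂ :=
  (ContinuousLinearMap.toSpanSingleton ℂ
    (((ξ : ℂ) - conj (ξ : ℂ)) / (1 - w) ^ 2)).restrictScalars ℝ

lemma det_fromDiscDeriv (ξ : ℍ) (w : ℂ) :
    (fromDiscDeriv ξ w).det = 4 * ξ.im ^ 2 / ‖1 - w‖ ^ 4 := by
  rw [fromDiscDeriv, sub_conj_self]
  simp [ContinuousLinearMap.det, LinearMap.det_restrictScalars,
      Algebra.norm_complex_eq, Complex.normSq_eq_norm_sq, ← pow_mul, abs_of_pos ξ.im_pos]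
  ring

lemma hasFDerivWithinAt_fromDisc (ξ : ℍ) {w : ℂ} (hw : w ∈ Metric.ball (0 : ℂ) 1) :
    HasFDerivWithinAt (fromDisc ξ) (fromDiscDeriv ξ w) (Metric.ball (0 : ℂ) 1) w :=
  ((hasDerivAt_fromDisc ξ hw).hasFDerivAt.restrictScalars ℝ).hasFDerivWithinAt

/-- The Jacobian 4 (Im ξ)² / |1 - w|⁴ divided by (Im τ)² leaves 4 / (1 - |w|²)²: the dependence on ξ
and on |1 - w| cancels. -/
lemma jacobian_smul_eq (ξ : ℍ) (φ : ℍ → E) {w : ℂ} (hw : w ∈ Metric.ball (0 : ℂ) 1) :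
    |(fromDiscDeriv ξ w).det| •
        ((1 / (fromDisc ξ w).im ^ 2) • φ (UpperHalfPlane.ofComplex (fromDisc ξ w))) =
      (4 / (1 - ‖w‖ ^ 2) ^ 2) • φ (discPoint ξ w) := by
  have h1 := norm_pos_iff.2 (one_sub_ne_zero hw)
  have h2 := one_sub_norm_sq_pos hw
  have h3 := ξ.im_pos
  rw [det_fromDiscDeriv, abs_of_nonneg (by positivity), fromDisc_im ξ hw, smul_smul, discPoint]
  congr 1
  field_simp

lemma integrable_uhp_iff_ball (ξ : ℍ) (φ : ℍ → E) :
    Integrable φ ↔ IntegrableOn (fun w : ℂ => (4 / (1 - ‖w‖ ^ 2) ^ 2) • φ (discPoint ξ w))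
      (Metric.ball 0 1) := by
  rw [integrable_uhp_iff, ← image_fromDisc ξ,
    integrableOn_image_iff_integrableOn_abs_det_fderiv_smul volume measurableSet_ball
      (fun w hw => hasFDerivWithinAt_fromDisc ξ hw) (injOn_fromDisc ξ)]
  exact integrableOn_congr_fun (fun w hw => jacobian_smul_eq ξ φ hw) measurableSet_ball

lemma integral_uhp_eq_ball (ξ : ℍ) (φ : ℍ → E) :
    ∫ τ, φ τ = ∫ w in Metric.ball (0 : ℂ) 1, (4 / (1 - ‖w‖ ^ 2) ^ 2) • φ (discPoint ξ w) := by
  rw [integral_uhp_eq, ← image_fromDisc ξ,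
    integral_image_eq_integral_abs_det_fderiv_smul volume measurableSet_ball
      (fun w hw => hasFDerivWithinAt_fromDisc ξ hw) (injOn_fromDisc ξ)]
  exact setIntegral_congr_fun measurableSet_ball fun w hw => jacobian_smul_eq ξ φ hw

end Measure

/-! ### Taylor coefficients by integration over circles -/

section PowerSeriesOnDisc

lemma integral_exp_int_mul_I (m : ℤ) :
    ∫ θ in (-Real.pi)..Real.pi, Complex.exp (m * Complex.I * (θ : ℂ)) =
      if m = 0 then 2 * (Real.pi : ℂ) else 0 := by
  split_ifs with h
  · simp [h]; ring
  · have hc : (m : ℂ) * Complex.I ≠ 0 := mul_ne_zero (by exact_mod_cast h) Complex.I_ne_zero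
    rw [integral_exp_mul_complex hc, div_eq_zero_iff, sub_eq_zero]
    left
    rw [Complex.exp_eq_exp_iff_exists_int]
    exact ⟨m, by push_cast; ring⟩

lemma mul_exp_mem_ball {r : ℝ} (hr0 : 0 ≤ r) (hr1 : r < 1) (θ : ℝ) :
    (r : ℂ) * Complex.exp (θ * Complex.I) ∈ Metric.ball (0 : ℂ) 1 := by
  rw [mem_ball_zero_iff, norm_mul, Complex.norm_exp_ofReal_mul_I, Complex.norm_real, mul_one,
    Real.norm_of_nonneg hr0]
  exact hr1

variable {G : ℂ → ℂ} {b : ℕ → ℂ}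

/-- Orthogonality of the exponentials e^{inθ}. Termwise integration is dominated by ∑ |b_n| r^n,
which converges because the power series is summable at w = r. -/
lemma integral_circle_mul_conj_pow
    (hb : ∀ w ∈ Metric.ball (0 : ℂ) 1, HasSum (fun n => b n * w ^ n) (G w)) (ν : ℕ) {r : ℝ}
    (hr0 : 0 ≤ r) (hr1 : r < 1) :
    ∫ θ in (-Real.pi)..Real.pi, G (r * Complex.exp (θ * Complex.I)) *
      conj ((r : ℂ) * Complex.exp (θ * Complex.I)) ^ ν =
    2 * Real.pi * b ν * (r : ℂ) ^ (2 * ν) := by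
  have hF : ∀ (n : ℕ) (θ : ℝ), b n * ((r : ℂ) * Complex.exp (θ * Complex.I)) ^ n *
      conj ((r : ℂ) * Complex.exp (θ * Complex.I)) ^ ν =
      b n * (r : ℂ) ^ (n + ν) * Complex.exp (((n : ℤ) - (ν : ℤ) : ℤ) * Complex.I * (θ : ℂ)) := by
    intro n θ
    rw [map_mul, ← Complex.exp_conj, mul_pow, mul_pow, ← Complex.exp_nat_mul,
      ← Complex.exp_nat_mul, Complex.conj_ofReal]
    have : Complex.exp (((n : ℤ) - (ν : ℤ) : ℤ) * Complex.I * (θ : ℂ)) =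
        Complex.exp (n * (θ * Complex.I)) * Complex.exp (ν * conj ((θ : ℂ) * Complex.I)) := by
      rw [← Complex.exp_add]
      congr 1
      simp
      ring
    rw [this, pow_add]
    ring
  have hsum : Summable fun n => ‖b n‖ * r ^ n := by
    have h := (hb _ (mul_exp_mem_ball hr0 hr1 0)).summable.norm
    refine h.congr fun n => ?_
    rw [norm_mul, norm_pow, norm_mul, Complex.norm_exp_ofReal_mul_I, Complex.norm_real, mul_one,
      Real.norm_of_nonneg hr0]
  have key := intervalIntegral.hasSum_integral_of_dominated_convergence (μ := volume)
    (a := -Real.pi) (b := Real.pi)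
    (F := fun (n : ℕ) (θ : ℝ) => b n * ((r : ℂ) * Complex.exp (θ * Complex.I)) ^ n *
      conj ((r : ℂ) * Complex.exp (θ * Complex.I)) ^ ν)
    (f := fun θ : ℝ => G (r * Complex.exp (θ * Complex.I)) *
      conj ((r : ℂ) * Complex.exp (θ * Complex.I)) ^ ν)
    (fun n _ => ‖b n‖ * r ^ n) (fun n => ?_) (fun n => ?_) ?_ ?_ ?_
  · have h2 : ∀ n : ℕ, ∫ θ in (-Real.pi)..Real.pi,
        b n * ((r : ℂ) * Complex.exp (θ * Complex.I)) ^ n *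
          conj ((r : ℂ) * Complex.exp (θ * Complex.I)) ^ ν =
        if n = ν then 2 * Real.pi * b ν * (r : ℂ) ^ (2 * ν) else 0 := by
      intro n
      simp only [hF]
      rw [intervalIntegral.integral_const_mul, integral_exp_int_mul_I]
      by_cases h : n = ν
      · subst h
        simp only [sub_self, if_true]
        ring
      · have h' : (n : ℤ) - (ν : ℤ) ≠ 0 := by omega
        simp [h, h']
    simp only [h2] at key
    exact key.unique (hasSum_ite_eq ν _)
  · refine Continuous.aestronglyMeasurable ?_
    fun_prop
  · refine Filter.Eventually.of_forall fun θ _ => ?_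
    rw [norm_mul, norm_mul, norm_pow, norm_pow, RCLike.norm_conj]
    have h1 : ‖(r : ℂ) * Complex.exp (θ * Complex.I)‖ = r := by
      rw [norm_mul, Complex.norm_exp_ofReal_mul_I, Complex.norm_real, mul_one,
        Real.norm_of_nonneg hr0]
    rw [h1]
    exact mul_le_of_le_one_right (by positivity) (pow_le_one₀ hr0 hr1.le)
  · exact Filter.Eventually.of_forall fun _ _ => hsum
  · exact intervalIntegrable_const
  · exact Filter.Eventually.of_forall fun θ _ => (hb _ (mul_exp_mem_ball hr0 hr1 θ)).mul_right _

lemma eq_of_hasSum_on_ball {b' : ℕ → ℂ}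
    (hb : ∀ w ∈ Metric.ball (0 : ℂ) 1, HasSum (fun n => b n * w ^ n) (G w))
    (hb' : ∀ w ∈ Metric.ball (0 : ℂ) 1, HasSum (fun n => b' n * w ^ n) (G w)) : b = b' := by
  funext ν
  have h := (integral_circle_mul_conj_pow hb ν (r := 1 / 2) (by norm_num) (by norm_num)).symm.trans
    (integral_circle_mul_conj_pow hb' ν (by norm_num) (by norm_num))
  have hpi : (Real.pi : ℂ) ≠ 0 := by exact_mod_cast Real.pi_ne_zero
  have h2 : ((1 / 2 : ℝ) : ℂ) ^ (2 * ν) ≠ 0 := pow_ne_zero _ (by norm_num)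
  exact mul_left_cancel₀ (mul_ne_zero two_ne_zero hpi) (mul_right_cancel₀ h2 h)

end PowerSeriesOnDisc

/-! ### Radial integrals -/

section Radial

/-- The substitution x = 1 - r² gives half the Beta value B(k - 1, ν + 1), a finite product since ν
is an integer. -/
lemma integral_radial_eq_beta (ν : ℕ) {k : ℝ} (hk : 2 < k) :
    ∫ r in (0 : ℝ)..1, r ^ (2 * ν + 1) * (1 - r ^ 2) ^ (k - 2) =
      (1 / 2) * ((ν.factorial : ℝ) / ∏ i ∈ Finset.range (ν + 1), (k - 1 + (i : ℝ))) := by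
  have h1 : ∫ x in (0 : ℝ)..1, x ^ (k - 2) * (1 - x) ^ ν =
      (ν.factorial : ℝ) / ∏ i ∈ Finset.range (ν + 1), (k - 1 + (i : ℝ)) := by
    have hB := Complex.betaIntegral_eval_nat_add_one_right
      (u := ((k - 1 : ℝ) : ℂ)) (by rw [Complex.ofReal_re]; linarith) ν
    rw [Complex.betaIntegral] at hB
    have h2 : ∫ x in (0 : ℝ)..1, (x : ℂ) ^ (((k - 1 : ℝ) : ℂ) - 1) * (1 - (x : ℂ)) ^ ((ν : ℂ) + 1 - 1) =
        ((∫ x in (0 : ℝ)..1, x ^ (k - 2) * (1 - x) ^ ν : ℝ) : ℂ) := by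
      rw [← intervalIntegral.integral_ofReal]
      refine intervalIntegral.integral_congr fun x hx => ?_
      rw [Set.uIcc_of_le zero_le_one] at hx
      rw [add_sub_cancel_right, Complex.cpow_natCast, Complex.ofReal_mul,
        Complex.ofReal_cpow hx.1]
      push_cast
      congr 2
      ring
    rw [h2] at hB
    exact_mod_cast hB
  have h3 := intervalIntegral.integral_comp_mul_deriv (a := 0) (b := 1)
    (f := fun r : ℝ => 1 - r ^ 2) (f' := fun r => -(2 * r))
    (g := fun x : ℝ => x ^ (k - 2) * (1 - x) ^ ν)
    (fun x _ => by simpa using (hasDerivAt_pow 2 x).const_sub 1) (by fun_prop)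
    ((Real.continuous_rpow_const (by linarith)).mul (by fun_prop))
  norm_num at h3
  rw [intervalIntegral.integral_symm 0 1, h1] at h3
  have h4 : ∀ r : ℝ, (1 - r ^ 2) ^ (k - 2) * (r ^ 2) ^ ν * (2 * r) =
      2 * (r ^ (2 * ν + 1) * (1 - r ^ 2) ^ (k - 2)) := fun r => by ring
  simp only [h4] at h3
  rw [intervalIntegral.integral_const_mul] at h3
  linarith

/-- The integrand may blow up at r = 1, but it is nonnegative and has an antiderivative that is
continuous up to the endpoint because a + 1 > 0. -/
lemma integrableOn_mul_one_sub_sq_rpow {a : ℝ} (ha : -1 < a) :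
    IntegrableOn (fun r : ℝ => r * (1 - r ^ 2) ^ a) (Set.Ioo 0 1) := by
  have h : IntegrableOn (fun r : ℝ => r * (1 - r ^ 2) ^ a) (Set.Ioc 0 1) := by
    refine intervalIntegral.integrableOn_deriv_of_nonneg
      (g := fun r => -(1 / (2 * (a + 1))) * (1 - r ^ 2) ^ (a + 1)) ?_ ?_ ?_
    · exact (continuous_const.mul ((Real.continuous_rpow_const (by linarith)).comp
        (by fun_prop : Continuous fun r : ℝ => 1 - r ^ 2))).continuousOn
    · intro r hr
      have hr1 : 0 < 1 - r ^ 2 := by nlinarith [hr.1, hr.2]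
      have h1 : HasDerivAt (fun r : ℝ => 1 - r ^ 2) (-(2 * r)) r := by
        simpa using (hasDerivAt_pow 2 r).const_sub 1
      refine ((h1.rpow_const (p := a + 1) (Or.inl hr1.ne')).const_mul _).congr_deriv ?_
      have : a + 1 ≠ 0 := by linarith
      rw [add_sub_cancel_right]
      field_simp
    · intro r hr
      have hr1 : 0 < 1 - r ^ 2 := by nlinarith [hr.1, hr.2]
      have := hr.1
      positivity
  exact h.mono_set Set.Ioo_subset_Ioc_self

lemma integrableOn_ball_one_sub_norm_sq_rpow {a : ℝ} (ha : -1 < a) :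
    IntegrableOn (fun w : ℂ => (1 - ‖w‖ ^ 2) ^ a) (Metric.ball 0 1) := by
  rw [integrableOn_fun_norm_addHaar volume (f := fun r : ℝ => (1 - r ^ 2) ^ a),
    Complex.finrank_real_complex]
  simpa using integrableOn_mul_one_sub_sq_rpow ha

end Radial

/-! ### The weighted disc integral in polar coordinates -/

section Polar

lemma integral_ball_eq_polar (h : ℂ → ℂ) :
    ∫ w in Metric.ball (0 : ℂ) 1, h w =
      ∫ q in Set.Ioo (0 : ℝ) 1 ×ˢ Set.Ioo (-Real.pi) Real.pi,
        q.1 • h ((q.1 : ℂ) * Complex.exp (q.2 * Complex.I)) := by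
  have hm : MeasurableSet (Set.Iio (1 : ℝ) ×ˢ (Set.univ : Set ℝ)) :=
    measurableSet_Iio.prod MeasurableSet.univ
  have hset : Set.Ioo (0 : ℝ) 1 ×ˢ Set.Ioo (-Real.pi) Real.pi =
      polarCoord.target ∩ (Set.Iio (1 : ℝ) ×ˢ (Set.univ : Set ℝ)) := by
    rw [polarCoord_target, Set.prod_inter_prod, Set.inter_univ, Set.Ioi_inter_Iio]
  rw [← integral_indicator measurableSet_ball, ← Complex.integral_comp_polarCoord_symm, hset,
    ← setIntegral_indicator hm]
  refine setIntegral_congr_fun polarCoord.open_target.measurableSet fun q hq => ?_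
  have hq0 : 0 < q.1 := hq.1
  have hsymm : Complex.polarCoord.symm q = (q.1 : ℂ) * Complex.exp (q.2 * Complex.I) := by
    rw [Complex.polarCoord_symm_apply, Complex.exp_mul_I, Complex.ofReal_cos, Complex.ofReal_sin]
  have hiff : (q.1 : ℂ) * Complex.exp (q.2 * Complex.I) ∈ Metric.ball (0 : ℂ) 1 ↔ q.1 < 1 := by
    rw [mem_ball_zero_iff, norm_mul, Complex.norm_exp_ofReal_mul_I, Complex.norm_real, mul_one,
      Real.norm_of_nonneg hq0.le]
  simp only [hsymm, Set.indicator, hiff, Set.mem_prod, Set.mem_Iio, Set.mem_univ, and_true]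
  split_ifs <;> simp

/-- Half of the weight is spent on bounding x. What remains has exponent k/2 - 2, which exceeds -1
exactly when k > 2. -/
lemma norm_mul_conj_pow_mul_rpow_le {w : ℂ} (hw : w ∈ Metric.ball (0 : ℂ) 1) {x : ℂ} {k C : ℝ}
    (hC : ‖x‖ * (1 - ‖w‖ ^ 2) ^ (k / 2) ≤ C) (ν : ℕ) :
    ‖x * conj w ^ ν * (((1 - ‖w‖ ^ 2) ^ (k - 2) : ℝ) : ℂ)‖ ≤ (1 - ‖w‖ ^ 2) ^ (k / 2 - 2) * C := by
  have hpos := one_sub_norm_sq_pos hw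
  rw [norm_mul, norm_mul, norm_pow, RCLike.norm_conj, Complex.norm_real,
    Real.norm_of_nonneg (by positivity)]
  have h2 : (1 - ‖w‖ ^ 2) ^ (k - 2) = (1 - ‖w‖ ^ 2) ^ (k / 2) * (1 - ‖w‖ ^ 2) ^ (k / 2 - 2) := by
    rw [← Real.rpow_add hpos]; congr 1; ring
  have h3 : ‖w‖ ^ ν ≤ 1 := pow_le_one₀ (norm_nonneg w) (mem_ball_zero_iff.1 hw).le
  have h4 : 0 ≤ (1 - ‖w‖ ^ 2) ^ (k / 2 - 2) := by positivity
  calc _ = ‖w‖ ^ ν * ((1 - ‖w‖ ^ 2) ^ (k / 2 - 2) * (‖x‖ * (1 - ‖w‖ ^ 2) ^ (k / 2))) := by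
        rw [h2]; ring
    _ ≤ 1 * ((1 - ‖w‖ ^ 2) ^ (k / 2 - 2) * (‖x‖ * (1 - ‖w‖ ^ 2) ^ (k / 2))) :=
        mul_le_mul_of_nonneg_right h3 (by positivity)
    _ ≤ _ := by rw [one_mul]; exact mul_le_mul_of_nonneg_left hC h4

lemma continuousOn_mul_conj_pow_mul_rpow {G : ℂ → ℂ}
    (hG : ContinuousOn G (Metric.ball (0 : ℂ) 1)) (ν : ℕ) {k : ℝ} (hk : 2 < k) :
    ContinuousOn (fun w => G w * conj w ^ ν * (((1 - ‖w‖ ^ 2) ^ (k - 2) : ℝ) : ℂ))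
      (Metric.ball (0 : ℂ) 1) := by
  refine (hG.mul (by fun_prop)).mul (Continuous.continuousOn ?_)
  refine Complex.continuous_ofReal.comp ((Real.continuous_rpow_const (by linarith)).comp ?_)
  fun_prop

lemma integrableOn_ball_mul_conj_pow {G : ℂ → ℂ}
    (hG : ContinuousOn G (Metric.ball (0 : ℂ) 1)) (ν : ℕ) {k : ℝ} (hk : 2 < k) {C : ℝ}
    (hC : ∀ w ∈ Metric.ball (0 : ℂ) 1, ‖G w‖ * (1 - ‖w‖ ^ 2) ^ (k / 2) ≤ C) :
    IntegrableOn (fun w => G w * conj w ^ ν * (((1 - ‖w‖ ^ 2) ^ (k - 2) : ℝ) : ℂ))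
      (Metric.ball 0 1) :=
  Integrable.mono'
    ((integrableOn_ball_one_sub_norm_sq_rpow (by linarith : -1 < k / 2 - 2)).mul_const C)
    ((continuousOn_mul_conj_pow_mul_rpow hG ν hk).aestronglyMeasurable measurableSet_ball)
    ((ae_restrict_iff' measurableSet_ball).2 (Filter.Eventually.of_forall fun w hw =>
      norm_mul_conj_pow_mul_rpow_le hw (hC w hw) ν))

lemma integral_ball_mul_conj_pow {G : ℂ → ℂ} {b : ℕ → ℂ}
    (hG : ContinuousOn G (Metric.ball (0 : ℂ) 1))
    (hb : ∀ w ∈ Metric.ball (0 : ℂ) 1, HasSum (fun n => b n * w ^ n) (G w)) (ν : ℕ) {k : ℝ}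
    (hk : 2 < k) {C : ℝ}
    (hC : ∀ w ∈ Metric.ball (0 : ℂ) 1, ‖G w‖ * (1 - ‖w‖ ^ 2) ^ (k / 2) ≤ C) :
    ∫ w in Metric.ball (0 : ℂ) 1, G w * conj w ^ ν * (((1 - ‖w‖ ^ 2) ^ (k - 2) : ℝ) : ℂ) =
      (Real.pi * ((ν.factorial : ℝ) / ∏ i ∈ Finset.range (ν + 1), (k - 1 + (i : ℝ))) : ℝ) *
        b ν := by
  have hnorm : ∀ r ∈ Set.Ioo (0 : ℝ) 1, ∀ θ : ℝ,
      ‖(r : ℂ) * Complex.exp (θ * Complex.I)‖ = r := fun r hr θ => by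
    rw [norm_mul, Complex.norm_exp_ofReal_mul_I, Complex.norm_real, mul_one,
      Real.norm_of_nonneg hr.1.le]
  have hmem : ∀ q ∈ Set.Ioo (0 : ℝ) 1 ×ˢ Set.Ioo (-Real.pi) Real.pi,
      (q.1 : ℂ) * Complex.exp (q.2 * Complex.I) ∈ Metric.ball (0 : ℂ) 1 :=
    fun q hq => mul_exp_mem_ball hq.1.1.le hq.1.2 q.2
  set h : ℂ → ℂ := fun w => G w * conj w ^ ν * (((1 - ‖w‖ ^ 2) ^ (k - 2) : ℝ) : ℂ) with hh
  have hcont : ContinuousOn h (Metric.ball (0 : ℂ) 1) :=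
    continuousOn_mul_conj_pow_mul_rpow hG ν hk
  have hint : IntegrableOn (fun q : ℝ × ℝ => q.1 • h ((q.1 : ℂ) * Complex.exp (q.2 * Complex.I)))
      (Set.Ioo (0 : ℝ) 1 ×ˢ Set.Ioo (-Real.pi) Real.pi) := by
    -- A majorant independent of the angle, integrable on the rectangle, which justifies Fubini
    -- below.
    have hbd : IntegrableOn (fun q : ℝ × ℝ => (q.1 * (1 - q.1 ^ 2) ^ (k / 2 - 2)) * C)
        (Set.Ioo (0 : ℝ) 1 ×ˢ Set.Ioo (-Real.pi) Real.pi) := by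
      rw [IntegrableOn, Measure.volume_eq_prod, ← Measure.prod_restrict]
      exact (integrableOn_mul_one_sub_sq_rpow (by linarith : -1 < k / 2 - 2)).mul_prod
        (integrable_const C)
    refine Integrable.mono' hbd ?_ ?_
    · refine ContinuousOn.aestronglyMeasurable ?_ (measurableSet_Ioo.prod measurableSet_Ioo)
      refine continuous_fst.continuousOn.smul (hcont.comp (Continuous.continuousOn ?_) hmem)
      fun_prop
    · refine (ae_restrict_iff' (measurableSet_Ioo.prod measurableSet_Ioo)).2
        (Filter.Eventually.of_forall fun q hq => ?_)
      have h1 := norm_mul_conj_pow_mul_rpow_le (hmem q hq) (hC _ (hmem q hq)) ν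
      rw [hnorm _ hq.1] at h1
      rw [norm_smul, Real.norm_of_nonneg hq.1.1.le, mul_assoc]
      refine mul_le_mul_of_nonneg_left ?_ hq.1.1.le
      simpa only [hh, hnorm _ hq.1] using h1
  rw [integral_ball_eq_polar, Measure.volume_eq_prod, setIntegral_prod _ (by
    rwa [← Measure.volume_eq_prod])]
  have hinner : ∀ r ∈ Set.Ioo (0 : ℝ) 1,
      ∫ θ in Set.Ioo (-Real.pi) Real.pi, r • h ((r : ℂ) * Complex.exp (θ * Complex.I)) =
        ((r ^ (2 * ν + 1) * (1 - r ^ 2) ^ (k - 2) : ℝ) : ℂ) * (2 * Real.pi * b ν) := by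
    intro r hr
    have h1 := integral_circle_mul_conj_pow hb ν hr.1.le hr.2
    rw [intervalIntegral.integral_of_le (by linarith [Real.pi_pos]),
      integral_Ioc_eq_integral_Ioo] at h1
    have h2 : ∀ θ : ℝ, r • h ((r : ℂ) * Complex.exp (θ * Complex.I)) =
        ((r * (1 - r ^ 2) ^ (k - 2) : ℝ) : ℂ) * (G (r * Complex.exp (θ * Complex.I)) *
      conj ((r : ℂ) * Complex.exp (θ * Complex.I)) ^ ν) := by
      intro θ
      simp only [hh, hnorm r hr, Complex.real_smul]
      push_cast
      ring
    simp only [h2]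
    rw [integral_const_mul, h1]
    push_cast
    ring
  rw [setIntegral_congr_fun measurableSet_Ioo hinner, integral_mul_const, integral_complex_ofReal,
    ← integral_Ioc_eq_integral_Ioo, ← intervalIntegral.integral_of_le zero_le_one,
    integral_radial_eq_beta ν hk]
  push_cast
  ring

end Polar

/-! ### Boundedness of cuspidal forms -/

section CuspBound

open Filter Topology

lemma norm_exp_two_pi_I_mul (x : ℝ) (τ : ℍ) :
    ‖Complex.exp (2 * Real.pi * Complex.I * (x : ℂ) * (τ : ℂ))‖ =
      Real.exp (-(2 * Real.pi * x) * τ.im) := by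
  rw [Complex.norm_exp]
  congr 1
  simp

/-- Absolute convergence at τ = i controls the whole region Im τ ≥ 1, after the slowest exponential,
of rate 2πh/N > 0, is factored out. -/
lemma exists_exp_decay_of_hasFourierExpansionFrom {h : ℤ} (hh : 0 < h) {f : ℍ → ℂ}
    (hf : HasFourierExpansionFrom h f) :
    ∃ c S : ℝ, 0 < c ∧ ∀ τ : ℍ, 1 ≤ τ.im → ‖f τ‖ ≤ S * Real.exp (-c * τ.im) := by
  obtain ⟨N, hN, a, ha⟩ := hf
  have hNr : (0 : ℝ) < N := by exact_mod_cast hN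
  have hhr : (0 : ℝ) < h := by exact_mod_cast hh
  have hx : ∀ m : ℕ, ((h : ℂ) + (m : ℂ)) / (N : ℂ) = (((h + m) / N : ℝ) : ℂ) := fun m => by
    push_cast; rfl
  have hnorm : ∀ (m : ℕ) (τ : ℍ), ‖a m * Complex.exp (2 * Real.pi * Complex.I *
      (((h : ℂ) + (m : ℂ)) / (N : ℂ)) * (τ : ℂ))‖ =
      ‖a m‖ * Real.exp (-(2 * Real.pi * ((h + m) / N)) * τ.im) := fun m τ => by
    rw [norm_mul, hx, norm_exp_two_pi_I_mul]
  have hs : Summable fun m : ℕ => ‖a m‖ * Real.exp (-(2 * Real.pi * ((h + m) / N))) := by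
    refine (ha UpperHalfPlane.I).summable.norm.congr fun m => ?_
    rw [hnorm, UpperHalfPlane.I_im, mul_one]
  set c : ℝ := 2 * Real.pi * (h / N) with hc
  refine ⟨c, (∑' m : ℕ, ‖a m‖ * Real.exp (-(2 * Real.pi * ((h + m) / N)))) * Real.exp c,
    by positivity, fun τ hτ => ?_⟩
  have hle : ∀ m : ℕ, ‖a m * Complex.exp (2 * Real.pi * Complex.I *
      (((h : ℂ) + (m : ℂ)) / (N : ℂ)) * (τ : ℂ))‖ ≤
      ‖a m‖ * Real.exp (-(2 * Real.pi * ((h + m) / N))) * Real.exp (c + -c * τ.im) := by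
    intro m
    rw [hnorm, mul_assoc ‖a m‖, ← Real.exp_add]
    refine mul_le_mul_of_nonneg_left (Real.exp_le_exp.2 ?_) (norm_nonneg _)
    have h1 : 2 * Real.pi * ((h + m) / N) = c + 2 * Real.pi * (m / N) := by rw [hc]; ring
    have h2 : 0 ≤ 2 * Real.pi * ((m : ℝ) / N) * (τ.im - 1) :=
      mul_nonneg (by positivity) (by linarith)
    rw [h1]
    linarith
  have h3 := tsum_of_norm_bounded (hs.mul_right (Real.exp (c + -c * τ.im))).hasSum hle
  rwa [(ha τ).tsum_eq, tsum_mul_right, Real.exp_add, ← mul_assoc] at h3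

lemma tendsto_norm_mul_im_rpow_of_hasFourierExpansionFrom {h : ℤ} (hh : 0 < h) {f : ℍ → ℂ}
    (hf : HasFourierExpansionFrom h f) (s : ℝ) :
    Tendsto (fun τ : ℍ => ‖f τ‖ * τ.im ^ s) UpperHalfPlane.atImInfty (𝓝 0) := by
  obtain ⟨c, S, hc, hS⟩ := exists_exp_decay_of_hasFourierExpansionFrom hh hf
  have him : Tendsto UpperHalfPlane.im UpperHalfPlane.atImInfty atTop := tendsto_comap
  have h1 := ((tendsto_rpow_mul_exp_neg_mul_atTop_nhds_zero s c hc).comp him).const_mul S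
  rw [mul_zero] at h1
  refine squeeze_zero' (Eventually.of_forall fun τ => ?_) ?_ h1
  · have := τ.im_pos
    positivity
  · filter_upwards [him.eventually_ge_atTop 1] with τ hτ
    have := τ.im_pos
    calc _ ≤ S * Real.exp (-c * τ.im) * τ.im ^ s :=
          mul_le_mul_of_nonneg_right (hS τ hτ) (by positivity)
      _ = _ := by simp only [Function.comp_apply]; ring

variable {p : ℕ} {k : ℝ} {v : SL(2, ℤ) → ℂ} {Γ : Subgroup SL(2, ℤ)} {ρ : Γ →* GL (Fin p) ℂ}

lemma norm_le_sum_norm (x : Vec p) : ‖x‖ ≤ ∑ i, ‖x i‖ := by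
  rw [EuclideanSpace.norm_eq]
  refine Real.sqrt_le_iff.2 ⟨by positivity, ?_⟩
  exact Finset.sum_sq_le_sq_sum_of_nonneg fun i _ => norm_nonneg _

lemma continuous_of_components {F : ℍ → Vec p}
    (hF : ∀ i, MDifferentiable 𝓘(ℂ) 𝓘(ℂ) fun τ => F τ i) : Continuous F := by
  have h : Continuous fun τ => WithLp.ofLp (F τ) := continuous_pi fun i => (hF i).continuous
  exact (PiLp.continuous_toLp 2 _).comp h

lemma IsCuspidalVVMF.continuous {F : ℍ → Vec p} (hF : IsCuspidalVVMF k v ρ F) : Continuous F :=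
  continuous_of_components fun i => (hF.1.1 i).1

/-- The function ‖F‖ Im^{k/2} is continuous, Γ-invariant because ρ is unitary, and tends to 0 at
every cusp by the exponential decay of the translates F|g. -/
lemma IsCuspidalVVMF.exists_bound [Γ.FiniteIndex] (hv : IsMultiplierSystem k v)
    (hρ : IsUnitaryRep ρ) {F : ℍ → Vec p} (hF : IsCuspidalVVMF k v ρ F) :
    ∃ C, ∀ τ, ‖F τ‖ * τ.im ^ (k / 2) ≤ C := by
  have hcont : Continuous fun τ : ℍ => ‖F τ‖ * τ.im ^ (k / 2) :=
    hF.continuous.norm.mul (UpperHalfPlane.continuous_im.rpow_const fun τ =>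
      Or.inl τ.im_pos.ne')
  have hbig : ∀ g : SL(2, ℤ), (fun τ : ℍ => ‖F (g • τ)‖ * (g • τ).im ^ (k / 2))
      =O[UpperHalfPlane.atImInfty] fun τ => τ.im ^ (0 : ℝ) := by
    intro g
    have h0 : Tendsto (fun τ : ℍ => ∑ i, ‖slash k v (fun τ => F τ i) g τ‖ * τ.im ^ (k / 2))
        UpperHalfPlane.atImInfty (𝓝 (∑ _i : Fin p, 0)) := by
      refine tendsto_finsetSum _ fun i _ => ?_
      obtain ⟨h, hh, hexp⟩ := (hF.2 i).2 g
      exact tendsto_norm_mul_im_rpow_of_hasFourierExpansionFrom hh hexp _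
    rw [Finset.sum_const_zero] at h0
    simp only [Real.rpow_zero]
    refine Tendsto.isBigO_one ℝ (squeeze_zero (fun τ => ?_) (fun τ => ?_) h0)
    · have := (g • τ).im_pos
      positivity
    · rw [← norm_slash_mul_im_rpow hv, ← Finset.sum_mul]
      exact mul_le_mul_of_nonneg_right (norm_le_sum_norm _) (Real.rpow_nonneg τ.im_pos.le _)
  have hinv : ∀ g ∈ Γ, ∀ τ : ℍ,
      ‖F (g • τ)‖ * (g • τ).im ^ (k / 2) = ‖F τ‖ * τ.im ^ (k / 2) := by
    intro g hg τ
    rw [← norm_slash_mul_im_rpow hv, hF.1.2 ⟨g, hg⟩ τ, norm_act_of_unitary (hρ _)]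
  obtain ⟨C, hC⟩ := ModularGroup.exists_bound_of_subgroup_invariant_of_isBigO hcont le_rfl
    hbig hinv
  refine ⟨C, fun τ => (le_abs_self _).trans ?_⟩
  simpa using hC τ

end CuspBound

/-! ### The elliptic expansion and the integral against the seed -/

section EllipticExpansion

/-- The function `w ↦ (τ - ξ̄)^k f(τ)` on the unit disc, where `τ` corresponds to `w` under the
Cayley transform. -/
def discFun (k : ℝ) (ξ : ℍ) (f : ℍ → ℂ) (w : ℂ) : ℂ :=
  ((discPoint ξ w : ℂ) - conj (ξ : ℂ)) ^ (k : ℂ) * f (discPoint ξ w)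

variable {k : ℝ} {ξ : ℍ} {f : ℍ → ℂ}

lemma differentiableOn_discFun (hf : MDifferentiable 𝓘(ℂ) 𝓘(ℂ) f) :
    DifferentiableOn ℂ (discFun k ξ f) (Metric.ball (0 : ℂ) 1) := by
  refine DifferentiableOn.mul (DifferentiableOn.cpow_const (DifferentiableOn.sub_const ?_ _)
    fun w _ => sub_conj_mem_slitPlane ξ (discPoint ξ w)) (differentiableOn_comp_discPoint ξ hf)
  exact differentiableOn_comp_discPoint ξ UpperHalfPlane.mdifferentiable_coe

/-- In the disc coordinate the elliptic expansion is an ordinary power series; existence is then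
Taylor's theorem on the disc and uniqueness is that of the coefficients. -/
lemma hasEllipticExpansion_iff {b : ℕ → ℂ} :
    HasEllipticExpansion k ξ f b ↔
      ∀ w ∈ Metric.ball (0 : ℂ) 1, HasSum (fun n => b n * w ^ n) (discFun k ξ f w) := by
  constructor
  · intro h w hw
    have h1 := h (discPoint ξ w)
    have h2 : ((discPoint ξ w : ℂ) - ξ) / ((discPoint ξ w : ℂ) - conj (ξ : ℂ)) = w := by
      rw [coe_discPoint ξ hw]
      exact toDisc_fromDisc ξ hw
    rwa [h2] at h1
  · intro h τ
    have h1 := h _ (toDisc_mem_ball ξ τ)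
    rwa [discFun, discPoint_toDisc] at h1

lemma existsUnique_hasEllipticExpansion (hf : MDifferentiable 𝓘(ℂ) 𝓘(ℂ) f) :
    ∃! b : ℕ → ℂ, HasEllipticExpansion k ξ f b := by
  refine ⟨fun n => (n.factorial : ℂ)⁻¹ * iteratedDeriv n (discFun k ξ f) 0,
    hasEllipticExpansion_iff.2 fun w hw => ?_, fun b hb => ?_⟩
  · refine (Complex.hasSum_taylorSeries_on_ball (differentiableOn_discFun hf) hw).congr_fun ?_
    intro n
    simp only [sub_zero, smul_eq_mul]
    ring
  · refine eq_of_hasSum_on_ball (hasEllipticExpansion_iff.1 hb) fun w hw => ?_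
    refine (Complex.hasSum_taylorSeries_on_ball (differentiableOn_discFun hf) hw).congr_fun ?_
    intro n
    simp only [sub_zero, smul_eq_mul]
    ring

/-- The identity behind this is Im τ = |τ - ξ̄|² (1 - |w|²) / (4 Im ξ). -/
lemma discPoint_im_rpow (ξ : ℍ) {w : ℂ} (hw : w ∈ Metric.ball (0 : ℂ) 1) (s : ℝ) :
    (discPoint ξ w).im ^ s = (‖(discPoint ξ w : ℂ) - conj (ξ : ℂ)‖ ^ 2) ^ s *
      (1 - ‖w‖ ^ 2) ^ s / (4 * ξ.im) ^ s := by
  have h1 := norm_pos_iff.2 (one_sub_ne_zero hw)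
  have h2 := one_sub_norm_sq_pos hw
  have h3 := ξ.im_pos
  rw [← Real.mul_rpow (by positivity) h2.le, ← Real.div_rpow (by positivity) (by positivity),
    norm_discPoint_sub_conj ξ hw, discPoint_im ξ hw]
  congr 1
  field_simp
  norm_num

lemma norm_discFun_mul_rpow (ξ : ℍ) (f : ℍ → ℂ) {w : ℂ} (hw : w ∈ Metric.ball (0 : ℂ) 1) :
    ‖discFun k ξ f w‖ * (1 - ‖w‖ ^ 2) ^ (k / 2) =
      (4 * ξ.im) ^ (k / 2) * (‖f (discPoint ξ w)‖ * (discPoint ξ w).im ^ (k / 2)) := by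
  have h0 := norm_pos_iff.2 (sub_conj_ne_zero ξ (discPoint ξ w))
  have h3 := ξ.im_pos
  have h4 : 0 < (4 * ξ.im) ^ (k / 2) := by positivity
  rw [discPoint_im_rpow ξ hw, discFun, norm_mul, Complex.norm_cpow_real,
    ← Real.rpow_natCast ‖(discPoint ξ w : ℂ) - conj (ξ : ℂ)‖, ← Real.rpow_mul h0.le]
  have : ((2 : ℕ) : ℝ) * (k / 2) = k := by push_cast; ring
  rw [this]
  field_simp

/-- The function `f(τ)` times the conjugate of `scalarSeed`, weighted by `Im(τ)^k`. -/
def seedIntegrand (k : ℝ) (ν : ℕ) (ξ : ℍ) (f : ℍ → ℂ) (τ : ℍ) : ℂ :=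
  f τ * conj (scalarSeed k ν ξ τ) * ((τ.im ^ k : ℝ) : ℂ)

/-- With Z = τ - ξ̄ the seed is w^ν / Z^k, and Im(τ)^k contributes |Z|^{2k} = Z^k · conj(Z^k). The
conjugate factor cancels the seed's denominator, and Z^k completes f to `discFun`. The conjugate is
taken of the power, never of its base, so no branch question arises. -/
lemma smul_seedIntegrand_discPoint (ν : ℕ) (ξ : ℍ) (f : ℍ → ℂ) {w : ℂ}
    (hw : w ∈ Metric.ball (0 : ℂ) 1) :
    (4 / (1 - ‖w‖ ^ 2) ^ 2) • seedIntegrand k ν ξ f (discPoint ξ w) =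
      ((4 / (4 * ξ.im) ^ k : ℝ) : ℂ) *
        (discFun k ξ f w * conj w ^ ν * (((1 - ‖w‖ ^ 2) ^ (k - 2) : ℝ) : ℂ)) := by
  have h0 := sub_conj_ne_zero ξ (discPoint ξ w)
  have h2 := one_sub_norm_sq_pos hw
  have hw' : (discPoint ξ w : ℂ) - ξ = ((discPoint ξ w : ℂ) - conj (ξ : ℂ)) * w := by
    have h := toDisc_fromDisc ξ hw
    rw [toDisc, ← coe_discPoint ξ hw, div_eq_iff h0] at h
    rw [h, mul_comm]
  rw [seedIntegrand, scalarSeed, discFun, discPoint_im_rpow ξ hw, hw']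
  set Z : ℂ := (discPoint ξ w : ℂ) - conj (ξ : ℂ) with hZ
  have hZk : Z ^ (k : ℂ) ≠ 0 := by simp [Complex.cpow_eq_zero_iff, h0]
  have hseed : (Z * w) ^ ν / Z ^ ((ν : ℂ) + (k : ℂ)) = w ^ ν / Z ^ (k : ℂ) := by
    rw [Complex.cpow_add _ _ h0, Complex.cpow_natCast, mul_pow,
      mul_div_mul_left _ _ (pow_ne_zero _ h0)]
  have hnorm : (((‖Z‖ ^ 2) ^ k : ℝ) : ℂ) = Z ^ (k : ℂ) * conj (Z ^ (k : ℂ)) := by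
    rw [Complex.mul_conj, Complex.normSq_eq_norm_sq, Complex.norm_cpow_real,
      ← Real.rpow_natCast, ← Real.rpow_natCast, ← Real.rpow_mul (norm_nonneg _),
      ← Real.rpow_mul (norm_nonneg _), mul_comm k]
  have hpow : (1 - ‖w‖ ^ 2) ^ (k - 2) = (1 - ‖w‖ ^ 2) ^ k / (1 - ‖w‖ ^ 2) ^ 2 := by
    rw [Real.rpow_sub h2, Real.rpow_two]
  have hc : conj (Z ^ (k : ℂ)) ≠ 0 := (map_ne_zero _).2 hZk
  rw [hseed, hpow, Complex.real_smul, Complex.ofReal_div (_ * _), Complex.ofReal_mul _ (_ ^ k),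
    hnorm, map_div₀, map_pow, Complex.ofReal_div 4, Complex.ofReal_div 4, Complex.ofReal_div (_ ^ k)]
  field_simp

variable {C : ℝ}

lemma integrable_seedIntegrand (hk : 2 < k) (ν : ℕ) (ξ : ℍ)
    (hf : MDifferentiable 𝓘(ℂ) 𝓘(ℂ) f) (hC : ∀ τ, ‖f τ‖ * τ.im ^ (k / 2) ≤ C) :
    Integrable (seedIntegrand k ν ξ f) := by
  rw [integrable_uhp_iff_ball ξ]
  refine (IntegrableOn.congr_fun ?_ (fun w hw => (smul_seedIntegrand_discPoint ν ξ f hw).symm)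
    measurableSet_ball)
  refine (integrableOn_ball_mul_conj_pow (differentiableOn_discFun hf).continuousOn ν hk
    (C := (4 * ξ.im) ^ (k / 2) * C) fun w hw => ?_).const_mul _
  rw [norm_discFun_mul_rpow ξ f hw]
  have := ξ.im_pos
  exact mul_le_mul_of_nonneg_left (hC _) (by positivity)

lemma integral_seedIntegrand (hk : 2 < k) (ν : ℕ) (ξ : ℍ)
    (hf : MDifferentiable 𝓘(ℂ) 𝓘(ℂ) f) (hC : ∀ τ, ‖f τ‖ * τ.im ^ (k / 2) ≤ C) {b : ℕ → ℂ}
    (hb : HasEllipticExpansion k ξ f b) :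
    ∫ τ, seedIntegrand k ν ξ f τ = ((4 * Real.pi / (4 * ξ.im) ^ k *
      ((ν.factorial : ℝ) / ∏ i ∈ Finset.range (ν + 1), (k - 1 + (i : ℝ))) : ℝ) : ℂ) * b ν := by
  rw [integral_uhp_eq_ball ξ, setIntegral_congr_fun measurableSet_ball
    fun w hw => smul_seedIntegrand_discPoint ν ξ f hw, integral_const_mul,
    integral_ball_mul_conj_pow (differentiableOn_discFun hf).continuousOn
      (hasEllipticExpansion_iff.1 hb) ν hk (C := (4 * ξ.im) ^ (k / 2) * C) fun w hw => ?_]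
  · push_cast
    ring
  · rw [norm_discFun_mul_rpow ξ f hw]
    have := ξ.im_pos
    exact mul_le_mul_of_nonneg_left (hC _) (by positivity)

end EllipticExpansion

/-! ### Unfolding over the group of transformations -/

section Unfolding

/-- The unfolding identity for an integrable function over a fundamental domain. -/
lemma integrableOn_tsum_smul_and_integral_eq {G α : Type*} [Group G] [Countable G] [MulAction G α]
    [MeasurableSpace α] [MeasurableConstSMul G α] {μ : Measure α} [SMulInvariantMeasure G α μ]
    {D : Set α} (hD : IsFundamentalDomain G D μ) {ψ : α → ℂ} (hψ : Integrable ψ μ)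
    (hm : AEStronglyMeasurable (fun x => ∑' g : G, ψ (g • x)) (μ.restrict D)) :
    IntegrableOn (fun x => ∑' g : G, ψ (g • x)) D μ ∧
      ∫ x in D, ∑' g : G, ψ (g • x) ∂μ = ∫ x, ψ x ∂μ := by
  have hmeas : ∀ g : G, AEStronglyMeasurable (fun x => ψ (g • x)) (μ.restrict D) := fun g =>
    (hψ.1.comp_measurePreserving (measurePreserving_smul g μ)).restrict
  -- Both claims rest on this: the sum equals the integral of |ψ| over the whole space, and its
  -- finiteness gives integrability and permits exchanging sum and integral.
  have hfin : ∑' g : G, ∫⁻ x in D, ‖ψ (g • x)‖ₑ ∂μ ≠ ⊤ := by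
    rw [← hD.lintegral_eq_tsum'' fun x => ‖ψ x‖ₑ]
    exact hψ.2.ne
  refine ⟨⟨hm, ?_⟩, ?_⟩
  · refine lt_of_le_of_lt (lintegral_mono fun x => enorm_tsum_le_tsum_enorm) ?_
    rw [lintegral_tsum fun g => (hmeas g).enorm]
    exact hfin.lt_top
  · rw [integral_tsum hmeas hfin, hD.integral_eq_tsum'' ψ hψ]

variable (Γ : Subgroup SL(2, ℤ))

/-- The group of transformations of `ℍ` induced by `Γ`. -/
abbrev transformations : Subgroup (Equiv.Perm ℍ) := Γ.map (MulAction.toPermHom SL(2, ℤ) ℍ)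

lemma continuous_SL_smul (γ : SL(2, ℤ)) : Continuous fun τ : ℍ => γ • τ :=
  continuous_const_smul (γ : GL (Fin 2) ℝ)

instance countable_transformations : Countable (transformations Γ) := by
  have h0 : Countable (Matrix (Fin 2) (Fin 2) ℤ) :=
    inferInstanceAs (Countable (Fin 2 → Fin 2 → ℤ))
  have h1 : Countable SL(2, ℤ) := Subtype.countable
  exact ((Set.to_countable (Γ : Set SL(2, ℤ))).image (MulAction.toPermHom SL(2, ℤ) ℍ)).to_subtype

instance measurableConstSMul_transformations : MeasurableConstSMul (transformations Γ) ℍ := by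
  refine ⟨?_⟩
  rintro ⟨_, γ, -, rfl⟩
  exact (continuous_SL_smul γ).measurable

instance smulInvariantMeasure_transformations :
    SMulInvariantMeasure (transformations Γ) ℍ volume := by
  refine ⟨?_⟩
  rintro ⟨_, γ, -, rfl⟩ s -
  exact measure_preimage_smul (volume : Measure ℍ) (γ : GL (Fin 2) ℝ) s

/-- It suffices to look at the single point 2i, which is interior to the standard fundamental domain
and so has stabiliser ±I. -/
lemma eq_one_or_eq_neg_one_of_forall_smul_eq {γ : SL(2, ℤ)} (h : ∀ τ : ℍ, γ • τ = τ) :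
    γ = 1 ∨ γ = -1 := by
  have h1 : (⟨2 * Complex.I, by simp⟩ : ℍ) ∈ ModularGroup.fdo := by
    refine ⟨?_, ?_⟩
    · simp [Complex.normSq_apply]; norm_num
    · simp [UpperHalfPlane.re]
  refine ModularGroup.eq_one_or_neg_one_of_mem_fdo_mem_fd h1 ?_
  rw [h]
  exact ModularGroup.fdo_subset_fd h1

variable {Γ}

/-- The cosets of `⟨-I⟩` in `Γ` correspond to the transformations of `ℍ` induced by `Γ`. -/
def cosetsEquivTransformations (hΓ : -1 ∈ Γ) :
    RightCosets (negOneSubgroup hΓ) ≃ transformations Γ :=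
  Equiv.ofBijective
    (fun q => ⟨MulAction.toPermHom SL(2, ℤ) ℍ (q.out : Γ), Subgroup.mem_map_of_mem _ q.out.2⟩) <| by
    have hmem : (⟨-1, hΓ⟩ : Γ) ∈ negOneSubgroup hΓ := Subgroup.mem_zpowers _
    constructor
    · intro q q' h
      have h1 : ∀ τ : ℍ, ((q'.out : Γ) : SL(2, ℤ)) • τ = ((q.out : Γ) : SL(2, ℤ)) • τ := fun τ =>
        (Equiv.congr_fun (congrArg Subtype.val h) τ).symm
      have h2 : ∀ τ : ℍ, (((q'.out * q.out⁻¹ : Γ) : Γ) : SL(2, ℤ)) • τ = τ := by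
        intro τ
        rw [Subgroup.coe_mul, mul_smul, h1, Subgroup.coe_inv, smul_inv_smul]
      rw [← Quotient.out_eq q, ← Quotient.out_eq q']
      refine Quotient.sound ?_
      change QuotientGroup.rightRel _ _ _
      rw [QuotientGroup.rightRel_apply]
      rcases eq_one_or_eq_neg_one_of_forall_smul_eq h2 with h | h
      · rw [show q'.out * q.out⁻¹ = 1 from Subtype.ext h]
        exact one_mem _
      · rw [show q'.out * q.out⁻¹ = ⟨-1, hΓ⟩ from Subtype.ext h]
        exact hmem
    · rintro ⟨_, γ, hγ, rfl⟩
      refine ⟨Quotient.mk _ ⟨γ, hγ⟩, Subtype.ext (Equiv.ext fun τ => ?_)⟩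
      have h : QuotientGroup.rightRel (negOneSubgroup hΓ)
        (Quotient.mk (QuotientGroup.rightRel (negOneSubgroup hΓ)) ⟨γ, hγ⟩).out ⟨γ, hγ⟩ :=
        Quotient.mk_out _
      rw [QuotientGroup.rightRel_apply] at h
      -- The chosen representative of the coset may differ from γ by an element of ⟨-I⟩, which is
      -- harmless because that subgroup acts trivially.
      have hact : ∀ l ∈ negOneSubgroup hΓ, ∀ τ : ℍ, (l : SL(2, ℤ)) • τ = τ := by
        intro l hl
        have hle : negOneSubgroup hΓ ≤ (MulAction.toPermHom Γ ℍ).ker := by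
          rw [negOneSubgroup, Subgroup.zpowers_le, MonoidHom.mem_ker]
          refine Equiv.ext fun τ => ?_
          change (-1 : SL(2, ℤ)) • τ = τ
          rw [ModularGroup.SL_neg_smul, one_smul]
        exact fun τ => Equiv.congr_fun (MonoidHom.mem_ker.1 (hle hl)) τ
      have h2 := hact _ h
        (((Quotient.mk (QuotientGroup.rightRel (negOneSubgroup hΓ)) ⟨γ, hγ⟩).out : Γ) • τ)
      rw [Subgroup.smul_def, smul_smul, ← Subgroup.coe_mul, inv_mul_cancel_right] at h2
      exact h2.symm

lemma cosetsEquivTransformations_smul (hΓ : -1 ∈ Γ) (q : RightCosets (negOneSubgroup hΓ)) (τ : ℍ) :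
    cosetsEquivTransformations hΓ q • τ = ((q.out : Γ) : SL(2, ℤ)) • τ := rfl

end Unfolding

/-! ### The Petersson integrand as a sum over transformations -/

section Petersson

variable {p : ℕ} {k : ℝ} {v : SL(2, ℤ) → ℂ} {Γ : Subgroup SL(2, ℤ)} {ρ : Γ →* GL (Fin p) ℂ}
  {hΓ : -1 ∈ Γ} {F : ℍ → Vec p}

/-- Since ρ(γ)⁻¹ is the adjoint of ρ(γ), it moves across the inner product and turns F into F|γ. The
two slash factors then combine to |j|^{-2k}, which is the factor relating Im(γτ)^k to Im(τ)^k. -/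
lemma peterssonIntegrand_slashRep (hv : IsMultiplierSystem k v) (hρ : IsUnitaryRep ρ)
    (hF : ∀ (γ : Γ) (τ : ℍ), slash k v F γ τ = act (ρ γ : Matrix (Fin p) (Fin p) ℂ) (F τ))
    (f : ℍ → Vec p) (γ : Γ) (τ : ℍ) :
    peterssonIntegrand k F (slashRep k v ρ f γ) τ =
      peterssonIntegrand k F f ((γ : SL(2, ℤ)) • τ) := by
  rw [peterssonIntegrand, peterssonIntegrand, sum_mul_conj_eq_inner, sum_mul_conj_eq_inner,
    slashRep, hρ.coe_inv, inner_act_left, star_star, ← hF, slash, slash, inner_smul_left,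
    inner_smul_right, ← mul_assoc, ← Complex.normSq_eq_conj_mul_self, Complex.normSq_eq_norm_sq,
    norm_slash_factor hv, im_smul_rpow]
  push_cast
  ring

lemma peterssonIntegrand_ellipticSeed_single (ν : ℕ) (ξ : ℍ) (j : Fin p) (F : ℍ → Vec p) :
    peterssonIntegrand k F (ellipticSeed k ν ξ (EuclideanSpace.single j 1)) =
      seedIntegrand k ν ξ fun τ => F τ j := by
  funext τ
  rw [peterssonIntegrand, ellipticSeed_eq, seedIntegrand, sum_mul_conj_eq_inner, inner_smul_left,
    EuclideanSpace.inner_single_left, map_one, one_mul, mul_comm (conj _)]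

lemma peterssonIntegrand_tsum {ι : Type*} {f : ι → ℍ → Vec p} {τ : ℍ}
    (hs : Summable fun i => f i τ) :
    peterssonIntegrand k F (fun τ => ∑' i, f i τ) τ =
      ∑' i, peterssonIntegrand k F (f i) τ := by
  simp only [peterssonIntegrand, sum_mul_conj_eq_inner]
  rw [tsum_mul_right]
  congr 1
  -- The inner product is conjugate-linear in its first argument, so only additivity and continuity
  -- are used to pass it through the sum.
  exact ((hs.hasSum.map (AddMonoidHom.mk' (fun x : Vec p => inner ℂ x (F τ))
    fun x y => inner_add_left x y _) (by simp only [AddMonoidHom.mk'_apply]; fun_prop)).tsum_eq).symm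

lemma continuous_peterssonIntegrand {G : ℍ → Vec p} (hF : Continuous F) (hG : Continuous G) :
    Continuous (peterssonIntegrand k F G) := by
  have h : Continuous fun τ : ℍ => τ.im ^ k :=
    UpperHalfPlane.continuous_im.rpow_const fun τ => Or.inl τ.im_pos.ne'
  simp only [funext fun τ => peterssonIntegrand.eq_1 k F G τ, sum_mul_conj_eq_inner]
  exact (hG.inner hF).mul (Complex.continuous_ofReal.comp h)

lemma peterssonIntegrand_ellipticSeries (hk : 2 < k) (hv : IsMultiplierSystem k v)
    (hρ : IsUnitaryRep ρ)
    (hF : ∀ (γ : Γ) (τ : ℍ), slash k v F γ τ = act (ρ γ : Matrix (Fin p) (Fin p) ℂ) (F τ))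
    (ν : ℕ) (ξ : ℍ) (j : Fin p) (τ : ℍ) :
    peterssonIntegrand k F (ellipticSeries k v hΓ ρ ν ξ (EuclideanSpace.single j 1)) τ =
      ∑' g : transformations Γ, seedIntegrand k ν ξ (fun τ => F τ j) (g • τ) := by
  rw [← (cosetsEquivTransformations hΓ).tsum_eq]
  refine (peterssonIntegrand_tsum (summable_ellipticTerm hk hv hρ ν ξ _ τ)).trans
    (tsum_congr fun q => ?_)
  rw [ellipticTerm, poincareTerm, peterssonIntegrand_slashRep hv hρ hF,
    peterssonIntegrand_ellipticSeed_single, cosetsEquivTransformations_smul]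

end Petersson

end VVMF

end

theorem proposition6p1 {p : ℕ} (hp : 0 < p) (k : ℝ) (hk : 2 < k)
    (v : SL(2, ℤ) → ℂ) (hv : VVMF.IsMultiplierSystem k v)
    (Γ : Subgroup SL(2, ℤ)) [Γ.FiniteIndex] (hΓ : -1 ∈ Γ)
    (ρ : Γ →* GL (Fin p) ℂ) (hρ : VVMF.IsUnitaryRep ρ) (hρ' : VVMF.IsNormalRep v hΓ ρ)
    (ν : ℕ) (ξ : ℍ) :
    (∀ u : VVMF.Vec p,
      (∀ K : Set ℍ, IsCompact K →
        SummableUniformlyOn (fun q τ => ‖VVMF.ellipticTerm k v hΓ ρ ν ξ u q τ‖) K ∧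
        HasSumUniformlyOn (VVMF.ellipticTerm k v hΓ ρ ν ξ u)
          (VVMF.ellipticSeries k v hΓ ρ ν ξ u) K) ∧
      VVMF.IsCuspidalVVMF k v ρ (VVMF.ellipticSeries k v hΓ ρ ν ξ u)) ∧
    (∀ (j : Fin p) (F : ℍ → VVMF.Vec p), VVMF.IsCuspidalVVMF k v ρ F →
      (∃! b : ℕ → ℂ, VVMF.HasEllipticExpansion k ξ (fun τ => F τ j) b) ∧
      ∀ b : ℕ → ℂ, VVMF.HasEllipticExpansion k ξ (fun τ => F τ j) b →
        ∀ D : Set ℍ, VVMF.IsFundDomain Γ D →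
          IntegrableOn (VVMF.peterssonIntegrand k F
            (VVMF.ellipticSeries k v hΓ ρ ν ξ (EuclideanSpace.single j 1))) D ∧
          VVMF.peterssonInner k D F
            (VVMF.ellipticSeries k v hΓ ρ ν ξ (EuclideanSpace.single j 1)) =
            ((4 * Real.pi / (4 * ξ.im) ^ k *
              ((ν.factorial : ℝ) / ∏ i ∈ Finset.range (ν + 1), (k - 1 + (i : ℝ))) : ℝ) : ℂ) *
              b ν) := by
  refine ⟨fun u => ⟨fun K hK => VVMF.hasSumUniformlyOn_ellipticTerm hk hv hρ ν ξ u hK,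
    VVMF.isCuspidalVVMF_ellipticSeries hk hv hρ hρ' ν ξ u⟩, fun j F hF => ?_⟩
  have hFj := (hF.1.1 j).1
  refine ⟨VVMF.existsUnique_hasEllipticExpansion hFj, fun b hb D hD => ?_⟩
  obtain ⟨C, hC⟩ := hF.exists_bound hv hρ
  have hCj : ∀ τ, ‖F τ j‖ * τ.im ^ (k / 2) ≤ C := fun τ =>
    (mul_le_mul_of_nonneg_right (PiLp.norm_apply_le (F τ) j)
      (Real.rpow_nonneg τ.im_pos.le _)).trans (hC τ)
  have heq := funext (VVMF.peterssonIntegrand_ellipticSeries (hΓ := hΓ) hk hv hρ hF.1.2 ν ξ j)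
  -- Continuity, which holds since both arguments are cuspidal forms, supplies the measurability of
  -- the unfolded sum.
  have hcont := VVMF.continuous_peterssonIntegrand (k := k) hF.continuous
    (VVMF.isCuspidalVVMF_ellipticSeries hk hv hρ hρ' ν ξ (EuclideanSpace.single j 1)).continuous
  rw [heq] at hcont
  have hunf := VVMF.integrableOn_tsum_smul_and_integral_eq hD
    (VVMF.integrable_seedIntegrand hk ν ξ hFj hCj) hcont.aestronglyMeasurable
  rw [VVMF.peterssonInner, heq]
  exact ⟨hunf.1, hunf.2.trans (VVMF.integral_seedIntegrand hk ν ξ hFj hCj hb)⟩
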